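/- **Setting.** $\mathbb R^n$ carries the sup norm; $B(x,r)$ is the closed ball. A system is $\Sigma=(X,X_{\rm in},U,\mathcal U,\xi^\to,\xi^\leftarrow)$ with $X\subseteq\mathbb R^n$, $U\subseteq\mathbb R^m$ bounded and convex, $X_{\rm in}\subseteq X$, $\mathcal U$ a set of signals $u:[0,\mathrm{len}(u)]\to U$ with $\mathrm{len}(u)>0$, and set-valued forward and backward dynamics $\xi^\to_{x,u}(t),\xi^\leftarrow_{x,u}(t)\subseteq\mathbb R^n$ which equal $\{x\}$ at $t=0$ (they are also given for tails of signals). A run is a sequence $x_0u_0x_1\dots$ with $x_i\in X$, $u_i\in\mathcal U$, $x_{i+1}\in\xi^\to_{x_i,u_i}(\mathrm{len}(u_i))$, $x_i\in\xi^\leftarrow_{x_{i+1},u_i}(\mathrm{len}(u_i))$, and $\xi^\to_{x_i,u_i}(t)\subseteq X$ for $t\le \mathrm{len}(u_i)$; finite runs are defined likewise. With $T_k=\sum_{i<k}\mathrm{len}(u_i)$, a trajectory of the run is $\sigma:\mathbb R_{\ge0}\to X$ with $\sigma(t)\in\xi^\to_{x_k,u_k}(t-T_k)\cap\xi^\leftarrow_{x_{k+1},u_k(\cdot+t-T_k)}(T_{k+1}-t)$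 for all $k$ and $t\in[T_k,T_{k+1}]$; similarly for finite runs. Assume: 1. (incremental completeness, with $\beta^\to,\beta^\leftarrow$) for $x\in\mathbb R^n$, $u\in\mathcal U$, $t\le\mathrm{len}(u)$ the sets $\xi^\to_{x,u}(t),\xi^\leftarrow_{x,u}(t)$ are non-empty, $\beta^\to_u(\cdot,t),\beta^\leftarrow_u(\cdot,t):\mathbb R_{\ge0}\to\mathbb R_{\ge0}$ are non-decreasing, and points of $\xi^\to_{x_1,u}(t)$ and $\xi^\to_{x_2,u}(t)$ are at distance at most $\beta_u^\to(\|x_1-x_2\|,t)$, and likewise for $\xi^\leftarrow,\beta^\leftarrow$; 2. (compatibility of the two dynamics) for all $x\in X$, $u\in\mathcal U$ there is $x'\in\xi^\to_{x,u}(\mathrm{len}(u))$ with $x\in\xi^\leftarrow_{x',u}(\mathrm{len}(u))$. A controller $C$ is a partial function from finite runs to signals. The runs and finite runs generated by $C/\Sigma$ are those with $x_0\in X_{\rm in}$ and $u_i=C(x_0u_0\dots x_i)$ for all $i$. **Symbolic model.** Let $\tau,\eta,\mu>0$, $\ell=[\ell_{\min},\ell_{\max}]$. $\mathcal U_{\tau,\ell,\mu}$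 is the set of signals $[0,j\tau]\to U\cap2\mu\mathbb Z^m$ with $j\ge1$, $j\tau\in\ell$, constant on each $[i\tau,(i+1)\tau)$, $i<j$; assume $\mathcal U_{\tau,\ell,\mu}\subseteq\mathcal U$. For $Y\subseteq\mathbb R^n$ let $[Y]_\eta=\{x\in2\eta\mathbb Z^n: B(x,\eta)\cap Y\ne\varnothing\}$. The symbolic model $S$ has states $Q=[X]_\eta$, initial states $Q_{\rm in}=[X_{\rm in}]_\eta$, signals $\mathcal U_{\tau,\ell,\mu}$, and $(q,u,q')\in\delta$ iff (i) $\xi^\to_{x,u}(t)\subseteq X$ for all $x\in B(q,\eta)$, $t\le \mathrm{len}(u)$; (ii) some $x'\in\xi^\to_{q,u}(\mathrm{len}(u))$ has $\|x'-q'\|\le\beta^\to_u(\eta,\mathrm{len}(u))+\eta$; (iii) some $x\in\xi^\leftarrow_{q',u}(\mathrm{len}(u))$ has $\|x-q\|\le\beta^\leftarrow_u(\eta,\mathrm{len}(u))+\eta$. Fix for each $x\in X$ a closest point $\overline x\in Q$. A symbolic controller $C$, a partial function from the finite runs of $S$ to $\mathcal U_{\tau,\ell,\mu}$, induces the controller $\overline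 C(x_0u_0\dots x_k)=C(\overline{x_0}u_0\dots\overline{x_k})$ of $\Sigma$. **Formulas.** $\phi::=\top\mid p\mid\neg\phi\mid\phi\vee\phi$ and $\Phi::=\phi\,\mathcal U\,\Phi\mid\Diamond\phi\mid\Box\phi\mid\Box\Diamond\phi\mid\Diamond\Box\phi\mid\Phi\vee\Phi\mid\Phi\wedge\Phi$ over atomic propositions $AP$, interpreted on $\sigma:\mathbb R_{\ge0}\to X$ through a map $P$ that sends a state to the set of propositions holding there, with the usual continuous-time semantics (in $\phi\,\mathcal U\,\Phi$: for some $t$, $\sigma(t+\cdot)\vDash\Phi$ and $\sigma(t')\vDash\phi$ for all $t'\le t$). Let $\rho_\forall,\rho_\exists$ map transitions to pairs $(P^+,P^-)$ of sets of propositions such that for all $(q,u,q')\in\delta$, all $x\in B(q,\eta)$, $x'\in B(q',\eta)$ for which $x\,u\,x'$ is a finite run, and all its trajectories $\sigma$, for all (resp. for some) $t\le\mathrm{len}(u)$: $P^+\subseteq P(\sigma(t))$ and $P^-\cap P(\sigma(t))=\varnothing$. Define $(P^+,P^-)\vDash\phi$ by $p\in P^+$ for $p$, $p\in P^-$ for $\neg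 p$, and induction through $\vee$, De Morgan's law and double negation. **Game.** A play of a mean-payoff parity game is won by Player-1 if it is infinite, the largest colour seen infinitely often is even, and $\liminf_n\frac1n\sum_{i=1}^n\lambda(e_i)\ge\nu$, where $\lambda(e_i)$ is the payoff of its $i$-th edge. A strategy may use the whole history of the play. It is winning from a vertex if against every Player-2 strategy the resulting play from there is won. The *base game* has Player-1 vertices $q\in Q$, Player-2 vertices $(q,u)$ with $u\in\mathcal U_{\tau,\ell,\mu}$, edges $q\to(q,u)$, and an edge $(q,u)\to q'$ for each $(q,u,q')\in\delta$, all of payoff $\mathrm{len}(u)$. For $\nu>0$ the game $G_{\Phi,\nu}$ consists of copies of it, one of them initial, with constant colour on each copy: * $\Box\phi,\Diamond\phi,\Box\Diamond\phi,\Diamond\Box\phi$: two copies, the first one initial, with colours $(0,1),(1,2),(1,2),(0,1)$ respectively. Edges $q\to(q,u)$ stay in their copy. An edge $(q,u)\to q'$ leads to the second copy iff: for $\Box\phi$, it starts there or $\rho_\forall(q,u,q')\nvDash\phi$; for $\Diamond\phi$, it starts there or $\rho_\exists(q,u,q')\vDash\phi$; for $\Box\Diamond\phi$, $\rho_\exists(q,u,q')\vDash\phi$;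 for $\Diamond\Box\phi$, $\rho_\forall(q,u,q')\nvDash\phi$. * $\phi\,\mathcal U\,\Phi$: $G_{\Phi,\nu}$ together with a new initial copy of colour $1$, in which $u$ is allowed at $q$ only if $\rho_\forall(q,u,q')\vDash\phi$ for all $(q,u,q')\in\delta$, and in which each $(q,u)$ is doubled: from one vertex all edges stay in the new copy, from the other all edges go to the initial copy of $G_{\Phi,\nu}$. * $\Phi\wedge\Psi$: the synchronised product of $G_{\Phi,\nu}$ and $G_{\Psi,\nu}$ (same $q$ and $u$, and an edge in each component), with a memory that records for each colour $a$ of the first component the largest colour of the second one seen since the last time $a$ was seen. At a vertex with colours $a,b$ let $b'$ be the maximum of $b$ and the colour recorded for $a$; the vertex gets the colour $2r(a,b')$ if $a$ and $b'$ are both even and $2r(a,b')+1$ otherwise, where $r$ is the rank of $(a,b')$ in the lexicographic order. * $\Phi\vee\Psi$: the same with "$a$ or $b'$ even", after replacing the missing edges of each component by edges to an additional absorbing copy of colour $1$. **Theorem.** There is one oracle algorithm such that the following holds for all data as above. Let $\sigma$ be a Player-1 strategy in $G_{\Phi,\nu}$ that is winning from every vertex $q\in Q_{\rm in}$ of the initial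 copy. Then there is a symbolic controller $C_\sigma$ such that * every finite run generated by $\overline{C_\sigma}/\Sigma$ extends to an infinite run generated by $\overline{C_\sigma}/\Sigma$ (which is in particular a run of $\Sigma$); * every trajectory of every infinite run generated by $\overline{C_\sigma}/\Sigma$ satisfies $\Phi$; * $\liminf_{h\to\infty}\frac1h\sum_{i=1}^h\mathrm{len}(u_i)\ge\nu$ for every infinite run $x_0u_0x_1\dots$ generated by $\overline{C_\sigma}/\Sigma$; and $C_\sigma$ is computed from $\sigma$ by the algorithm: given any finite table of the graph of $G_{\Phi,\nu}$ (with states, signals, vertices and edges named by natural numbers, the state of each Player-1 vertex, the signal of each Player-2 vertex and the initial copy), any finite run $h$ of $S$, and an oracle for the values of $\sigma$, it halts and returns $C_\sigma(h)$ (or reports that it is undefined). -/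

import Mathlib

open scoped NNReal

/-! ## Generic notions: histories, controllers, mean values -/

/-- A finite sequence `x₀ u₀ x₁ … u_{k-1} x_k`, stored as `x₀` and the list of the pairs
`(u_i, x_{i+1})`. -/
abbrev History (S A : Type) : Type := S × List (A × S)

/-- The relation `step x_i u_i x_{i+1}` holds for all `i < k` along `x₀ u₀ … x_k`. -/
def IsPath {S A : Type} (step : S → A → S → Prop) : S → List (A × S) → Prop
  | _, [] => True
  | x, (u, x') :: r => step x u x' ∧ IsPath step x' r

/-- The finite prefix `x₀ u₀ … x_k` of an infinite sequence `x₀ u₀ x₁ …`. -/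
def historyOf {S A : Type} (x : ℕ → S) (u : ℕ → A) (k : ℕ) : History S A :=
  (x 0, (List.range k).map fun i => (u i, x (i + 1)))

/-- A controller is a partial function from finite runs to control signals; it only has to be
defined on the finite runs that it generates. -/
abbrev Controller (S A : Type) : Type := History S A → Option A

/-- `liminf_{h → ∞} (1/h) ∑_{i=1}^h f i`, as an extended real number. -/
noncomputable def limitAverage (f : ℕ → ℝ) : EReal :=
  Filter.liminf (fun h : ℕ => (((1 / (h : ℝ)) * ∑ i ∈ Finset.Icc 1 h, f i : ℝ) : EReal))
    Filter.atTop

/-! ## Control signals and systems -/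

/-- A signal `[0, len] → ℝᵐ`. -/
structure Signal (m : ℕ) where
  len : ℝ≥0
  val : Set.Icc (0 : ℝ≥0) len → (Fin m → ℝ)

namespace Signal

/-- The value at time `t` (the final value for `t > len`). -/
def eval {m : ℕ} (u : Signal m) (t : ℝ≥0) : Fin m → ℝ :=
  u.val ⟨min t u.len, zero_le, min_le_right _ _⟩

/-- The signal `s ↦ u (s + a)` on `[0, len u - a]`, for `a ≤ len u`. -/
noncomputable def tail {m : ℕ} (u : Signal m) (a : ℝ≥0) : Signal m where
  len := u.len - a
  val s := u.eval (s + a)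

end Signal

/-- A non-deterministic continuous-time system. `ℝⁿ` is `Fin n → ℝ` with its sup norm.
The dynamics `fwd x u t`, `bwd x u t` are written as functions of every signal `u`, because
trajectories evaluate `bwd` at the tails of the control signals; the controller may use only
the signals of `signals`. -/
structure ControlSystem (n m : ℕ) where
  X : Set (Fin n → ℝ)
  X_bounded : Bornology.IsBounded X
  X_convex : Convex ℝ X
  Xin : Set (Fin n → ℝ)
  Xin_subset : Xin ⊆ X
  U : Set (Fin m → ℝ)
  U_bounded : Bornology.IsBounded U
  U_convex : Convex ℝ U
  signals : Set (Signal m)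
  signals_pos : ∀ u ∈ signals, 0 < u.len
  signals_mem : ∀ u ∈ signals, ∀ s, u.val s ∈ U
  fwd : (Fin n → ℝ) → Signal m → ℝ≥0 → Set (Fin n → ℝ)
  bwd : (Fin n → ℝ) → Signal m → ℝ≥0 → Set (Fin n → ℝ)
  fwd_zero : ∀ x u, fwd x u 0 = {x}
  bwd_zero : ∀ x u, bwd x u 0 = {x}

namespace ControlSystem

variable {n m : ℕ}

/-- Incremental forward and backward completeness, with bounds `βf` and `βb`. -/
structure IncrementallyComplete (sys : ControlSystem n m)
    (βf βb : Signal m → ℝ≥0 → ℝ≥0 → ℝ≥0) : Prop where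
  fwd_nonempty : ∀ x, ∀ u ∈ sys.signals, ∀ t ≤ u.len, (sys.fwd x u t).Nonempty
  bwd_nonempty : ∀ x, ∀ u ∈ sys.signals, ∀ t ≤ u.len, (sys.bwd x u t).Nonempty
  fwd_mono : ∀ u ∈ sys.signals, ∀ t, Monotone fun r => βf u r t
  bwd_mono : ∀ u ∈ sys.signals, ∀ t, Monotone fun r => βb u r t
  fwd_bound : ∀ x₁ x₂, ∀ u ∈ sys.signals, ∀ t ≤ u.len,
    ∀ y₁ ∈ sys.fwd x₁ u t, ∀ y₂ ∈ sys.fwd x₂ u t, ‖y₁ - y₂‖ ≤ βf u ‖x₁ - x₂‖₊ t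
  bwd_bound : ∀ x₁ x₂, ∀ u ∈ sys.signals, ∀ t ≤ u.len,
    ∀ y₁ ∈ sys.bwd x₁ u t, ∀ y₂ ∈ sys.bwd x₂ u t, ‖y₁ - y₂‖ ≤ βb u ‖x₁ - x₂‖₊ t

/-- The forward and the backward dynamics belong to the same system: from every state `x` every
signal `u` can lead to some `x'` which the backward dynamics can lead back to `x`. This holds in
particular if `x' ∈ fwd x u (len u)` implies `x ∈ bwd x' u (len u)`. -/
def BackwardCompatible (sys : ControlSystem n m) : Prop :=
  ∀ x ∈ sys.X, ∀ u ∈ sys.signals, ∃ x' ∈ sys.fwd x u u.len, x ∈ sys.bwd x' u u.len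

/-- One step `x u x'` of a run. -/
def Step (sys : ControlSystem n m) (x : sys.X) (u : Signal m) (x' : sys.X) : Prop :=
  u ∈ sys.signals ∧ (x' : Fin n → ℝ) ∈ sys.fwd x u u.len ∧
    (x : Fin n → ℝ) ∈ sys.bwd x' u u.len ∧ ∀ t ≤ u.len, sys.fwd x u t ⊆ sys.X

/-- `x₀ u₀ x₁ …` is an infinite run. -/
def IsRun (sys : ControlSystem n m) (x : ℕ → sys.X) (u : ℕ → Signal m) : Prop :=
  ∀ i, sys.Step (x i) (u i) (x (i + 1))

/-- `h` is a finite run. -/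
def IsFiniteRun (sys : ControlSystem n m) (h : History sys.X (Signal m)) : Prop :=
  IsPath sys.Step h.1 h.2

/-- An infinite run of the system controlled by `C`, from an initial state. -/
def IsControlledRun (sys : ControlSystem n m) (C : Controller sys.X (Signal m))
    (x : ℕ → sys.X) (u : ℕ → Signal m) : Prop :=
  sys.IsRun x u ∧ (x 0 : Fin n → ℝ) ∈ sys.Xin ∧ ∀ i, C (historyOf x u i) = some (u i)

/-- A finite run of the system controlled by `C`, from an initial state. -/
def IsControlledFiniteRun (sys : ControlSystem n m) (C : Controller sys.X (Signal m))
    (h : History sys.X (Signal m)) : Prop :=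
  sys.IsFiniteRun h ∧ (h.1 : Fin n → ℝ) ∈ sys.Xin ∧
    ∀ i (hi : i < h.2.length), C (h.1, h.2.take i) = some (h.2[i]).1

/-- `σ` is a trajectory induced by the run `x₀ u₀ x₁ …`. -/
def IsTrajectory (sys : ControlSystem n m) (x : ℕ → sys.X) (u : ℕ → Signal m)
    (σ : ℝ≥0 → (Fin n → ℝ)) : Prop :=
  (∀ t, σ t ∈ sys.X) ∧
  ∀ k t, ∑ i ∈ Finset.range k, (u i).len ≤ t → t ≤ ∑ i ∈ Finset.range (k + 1), (u i).len →
    σ t ∈ sys.fwd (x k) (u k) (t - ∑ i ∈ Finset.range k, (u i).len) ∩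
      sys.bwd (x (k + 1)) ((u k).tail (t - ∑ i ∈ Finset.range k, (u i).len))
        (∑ i ∈ Finset.range (k + 1), (u i).len - t)

/-- `σ`, restricted to `[0, len u]`, is a finite trajectory induced by the finite run `x u x'`. -/
def IsStepTrajectory (sys : ControlSystem n m) (x : sys.X) (u : Signal m) (x' : sys.X)
    (σ : ℝ≥0 → (Fin n → ℝ)) : Prop :=
  ∀ t ≤ u.len, σ t ∈ sys.X ∧ σ t ∈ sys.fwd x u t ∩ sys.bwd x' (u.tail t) (u.len - t)

end ControlSystem

/-! ## Right-recursive LTL -/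

inductive StateFormula (AP : Type*) where
  | top : StateFormula AP
  | atom : AP → StateFormula AP
  | neg : StateFormula AP → StateFormula AP
  | or : StateFormula AP → StateFormula AP → StateFormula AP

inductive PathFormula (AP : Type*) where
  | until : StateFormula AP → PathFormula AP → PathFormula AP
  | eventually : StateFormula AP → PathFormula AP
  | always : StateFormula AP → PathFormula AP
  | alwaysEventually : StateFormula AP → PathFormula AP
  | eventuallyAlways : StateFormula AP → PathFormula AP
  | or : PathFormula AP → PathFormula AP → PathFormula AP
  | and : PathFormula AP → PathFormula AP → PathFormula AP

/-- `x ⊨ φ`, for a state `x` at which exactly the atomic propositions in `L` hold. -/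
def StateFormula.Sat {AP : Type*} (L : Set AP) : StateFormula AP → Prop
  | .top => True
  | .atom p => p ∈ L
  | .neg φ => ¬ φ.Sat L
  | .or φ ψ => φ.Sat L ∨ ψ.Sat L

/-- `σ ⊨ Φ`. -/
def PathFormula.Sat {AP S : Type*} (P : S → Set AP) : (ℝ≥0 → S) → PathFormula AP → Prop
  | σ, .until φ Φ => ∃ t : ℝ≥0, Φ.Sat P (fun s => σ (t + s)) ∧ ∀ t' ≤ t, φ.Sat (P (σ t'))
  | σ, .eventually φ => ∃ t, φ.Sat (P (σ t))
  | σ, .always φ => ∀ t, φ.Sat (P (σ t))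
  | σ, .alwaysEventually φ => ∀ t, ∃ t' > t, φ.Sat (P (σ t'))
  | σ, .eventuallyAlways φ => ∃ t, ∀ t' > t, φ.Sat (P (σ t'))
  | σ, .or Φ Ψ => Φ.Sat P σ ∨ Ψ.Sat P σ
  | σ, .and Φ Ψ => Φ.Sat P σ ∧ Ψ.Sat P σ

/-- `φ.Certified ρ true` is `ρ ⊨ φ` and `φ.Certified ρ false` is `ρ ⊨ ¬φ`, for a pair
`ρ = (P⁺, P⁻)` of propositions known to be true and of propositions known to be false. -/
def StateFormula.Certified {AP : Type*} (ρ : Set AP × Set AP) : StateFormula AP → Bool → Prop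
  | .top, b => b = true
  | .atom p, true => p ∈ ρ.1
  | .atom p, false => p ∈ ρ.2
  | .neg φ, b => φ.Certified ρ (!b)
  | .or φ ψ, true => φ.Certified ρ true ∨ ψ.Certified ρ true
  | .or φ ψ, false => φ.Certified ρ false ∧ ψ.Certified ρ false

/-! ## The controller synthesis problem -/

/-- `C` solves the controller synthesis problem for `sys`, `P`, `Φ` and `ν`. Since controllers are
partial functions here, absence of deadlock is required of the controlled system itself: a finite
run that it generates extends to an infinite run that it generates. -/
def ControlSystem.Solves {n m : ℕ} {AP : Type*} (sys : ControlSystem n m)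
    (P : (Fin n → ℝ) → Set AP) (Φ : PathFormula AP) (ν : ℝ)
    (C : Controller sys.X (Signal m)) : Prop :=
  (∀ h, sys.IsControlledFiniteRun C h →
    ∃ x u, sys.IsControlledRun C x u ∧ historyOf x u h.2.length = h) ∧
  (∀ x u, sys.IsControlledRun C x u → ∀ σ, sys.IsTrajectory x u σ → Φ.Sat P σ) ∧
  (∀ x u, sys.IsControlledRun C x u → (ν : EReal) ≤ limitAverage fun i => ((u i).len : ℝ))

/-! ## Symbolic models -/

/-- A symbolic model with finite state set `Q` and a finite set of signals. -/
structure SymbolicModel (Q A : Type) where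
  finite_states : Finite Q
  init : Set Q
  signals : Set A
  finite_signals : signals.Finite
  trans : Q → A → Q → Prop
  trans_signal : ∀ q u q', trans q u q' → u ∈ signals

/-- `h` is a finite run of the symbolic model. -/
def SymbolicModel.IsFiniteRun {Q A : Type} (M : SymbolicModel Q A) (h : History Q A) : Prop :=
  IsPath M.trans h.1 h.2

/-- Time step, state and input quantisation parameters, and the signal length bounds. -/
structure QuantParams where
  τ : ℝ≥0
  η : ℝ≥0
  μ : ℝ≥0
  ℓmin : ℝ
  ℓmax : ℝ
  τ_pos : 0 < τ
  η_pos : 0 < η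
  μ_pos : 0 < μ

/-- The points `x ∈ 2ηℤⁿ` whose closed `η`-ball meets `Y`. -/
def gridStates {n : ℕ} (Y : Set (Fin n → ℝ)) (η : ℝ≥0) : Set (Fin n → ℝ) :=
  {x | (∀ i, ∃ l : ℤ, x i = 2 * η * l) ∧ (Metric.closedBall x η ∩ Y).Nonempty}

/-- The points of `U` that lie in `2μℤᵐ`. -/
def gridInputs {m : ℕ} (U : Set (Fin m → ℝ)) (μ : ℝ≥0) : Set (Fin m → ℝ) :=
  {v | v ∈ U ∧ ∀ i, ∃ l : ℤ, v i = 2 * μ * l}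

/-- The signals `[0, jτ] → U_μ` with `j ≥ 1` and `jτ ∈ [ℓmin, ℓmax]` which are constant on each
`[iτ, (i+1)τ)`, `i < j`. -/
def pwConstSignals {m : ℕ} (U : Set (Fin m → ℝ)) (p : QuantParams) : Set (Signal m) :=
  {u | ∃ j : ℕ, 0 < j ∧ u.len = j * p.τ ∧ (u.len : ℝ) ∈ Set.Icc p.ℓmin p.ℓmax ∧
    (∀ s, u.val s ∈ gridInputs U p.μ) ∧
    ∀ i < j, ∀ t : ℝ≥0, i * p.τ ≤ t → t < (i + 1) * p.τ → u.eval t = u.eval (i * p.τ)}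

theorem grid_finite {n : ℕ} {c : ℝ} (hc : 0 < c) (R : ℝ) :
    {x : Fin n → ℝ | (∀ i, ∃ l : ℤ, x i = c * l) ∧ ‖x‖ ≤ R}.Finite := by
  have hfin : (Set.univ.pi fun _ : Fin n => Set.Icc (-⌈R / c⌉) ⌈R / c⌉).Finite :=
    Set.Finite.pi fun _ => Set.finite_Icc _ _
  refine (hfin.image fun l : Fin n → ℤ => fun i => c * (l i : ℝ)).subset ?_
  rintro x ⟨hx, hR⟩
  choose l hl using hx
  refine ⟨l, fun i _ => ?_, funext fun i => (hl i).symm⟩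
  have h1 : |x i| ≤ R := (norm_le_pi_norm x i).trans hR
  rw [hl i, abs_mul, abs_of_pos hc] at h1
  have h2 : |(l i : ℝ)| ≤ R / c := by
    rw [le_div_iff₀ hc]; linarith
  have h3 : |(l i : ℝ)| ≤ (⌈R / c⌉ : ℝ) := h2.trans (Int.le_ceil _)
  have h4 := abs_le.mp h3
  exact ⟨by exact_mod_cast h4.1, by exact_mod_cast h4.2⟩

theorem gridStates_finite {n : ℕ} {Y : Set (Fin n → ℝ)} (hY : Bornology.IsBounded Y)
    {η : ℝ≥0} (hη : 0 < η) : (gridStates Y η).Finite := by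
  obtain ⟨R, hR⟩ := hY.exists_norm_le
  have hc : (0 : ℝ) < 2 * η := by positivity
  refine (grid_finite hc (R + η)).subset ?_
  rintro x ⟨hx, y, hy, hyY⟩
  refine ⟨hx, ?_⟩
  have h1 : ‖y - x‖ ≤ η := by simpa [dist_eq_norm] using hy
  have h2 := hR y hyY
  have h3 : ‖x‖ ≤ ‖y‖ + ‖y - x‖ := by
    have := norm_sub_le y (y - x)
    simpa using this
  linarith

theorem gridInputs_finite {m : ℕ} {U : Set (Fin m → ℝ)} (hU : Bornology.IsBounded U)
    {μ : ℝ≥0} (hμ : 0 < μ) : (gridInputs U μ).Finite := by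
  obtain ⟨R, hR⟩ := hU.exists_norm_le
  have hc : (0 : ℝ) < 2 * μ := by positivity
  exact (grid_finite hc R).subset fun x hx => ⟨hx.2, hR x hx.1⟩

theorem Signal.ext_eval {m : ℕ} {u v : Signal m} (hlen : u.len = v.len)
    (h : ∀ t ≤ u.len, u.eval t = v.eval t) : u = v := by
  obtain ⟨T, f⟩ := u
  obtain ⟨T', g⟩ := v
  obtain rfl : T = T' := hlen
  congr 1
  funext s
  have hs : (s : ℝ≥0) ≤ T := s.2.2
  have := h s hs
  simpa [Signal.eval, hs] using this

theorem pwConstSignals_finite {m : ℕ} {U : Set (Fin m → ℝ)} (hU : Bornology.IsBounded U)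
    (p : QuantParams) : (pwConstSignals U p).Finite := by
  classical
  have hfinU : Finite (gridInputs U p.μ) := (gridInputs_finite hU p.μ_pos).to_subtype
  have hτ : (0 : ℝ) < p.τ := p.τ_pos
  let J : ℕ := ⌈p.ℓmax / p.τ⌉₊
  have hJ : ∀ j : ℕ, (j * p.τ : ℝ) ≤ p.ℓmax → j ≤ J := by
    intro j hj
    have : (j : ℝ) ≤ p.ℓmax / p.τ := by rwa [le_div_iff₀ hτ]
    exact_mod_cast this.trans (Nat.le_ceil _)
  let F : pwConstSignals U p → Fin (J + 1) × (Fin (J + 1) → gridInputs U p.μ) := fun u =>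
    (⟨u.2.choose, Nat.lt_succ_of_le (hJ _ (by
        have h := u.2.choose_spec
        have h1 : (u.1.len : ℝ) ≤ p.ℓmax := h.2.2.1.2
        rw [h.2.1] at h1
        simpa using h1))⟩,
      fun i => ⟨u.1.eval (i * p.τ), u.2.choose_spec.2.2.2.1 _⟩)
  have hF : Function.Injective F := by
    intro u v huv
    have hj : u.2.choose = v.2.choose := by
      have := congrArg (fun z => (z.1 : ℕ)) huv
      simpa [F] using this
    have hval : ∀ i ≤ J, u.1.eval (i * p.τ) = v.1.eval (i * p.τ) := by
      intro i hi
      have := congrArg (fun z => (z.2 ⟨i, Nat.lt_succ_of_le hi⟩ : Fin m → ℝ)) huv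
      simpa [F] using this
    obtain ⟨-, hul, hur, -, huc⟩ := u.2.choose_spec
    obtain ⟨-, hvl, -, -, hvc⟩ := v.2.choose_spec
    have huJ : u.2.choose ≤ J := by
      refine hJ _ ?_
      have h1 : (u.1.len : ℝ) ≤ p.ℓmax := hur.2
      rw [hul] at h1
      simpa using h1
    have hlen : u.1.len = v.1.len := by rw [hul, hvl, hj]
    refine Subtype.ext (Signal.ext_eval hlen ?_)
    intro t ht
    rcases ht.lt_or_eq with ht | ht
    · have hfl := Nat.floor_le (show (0 : ℝ≥0) ≤ t / p.τ from zero_le)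
      have hlt := Nat.lt_floor_add_one (t / p.τ)
      have h1 : (⌊t / p.τ⌋₊ : ℝ≥0) * p.τ ≤ t := by
        rwa [le_div_iff₀ p.τ_pos] at hfl
      have h2 : t < ((⌊t / p.τ⌋₊ : ℝ≥0) + 1) * p.τ := by
        rwa [div_lt_iff₀ p.τ_pos] at hlt
      have h3 : ⌊t / p.τ⌋₊ < u.2.choose := by
        rw [hul] at ht
        have := h1.trans_lt ht
        exact_mod_cast lt_of_mul_lt_mul_right this zero_le
      rw [huc _ h3 t h1 h2, hvc _ (hj ▸ h3) t h1 h2]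
      exact hval _ (h3.le.trans huJ)
    · rw [ht, hul]
      exact hval _ huJ
  exact Set.finite_coe_iff.mp (Finite.of_injective F hF)

/-- The symbolic model of `sys`. -/
def ControlSystem.symbolicModel {n m : ℕ} (sys : ControlSystem n m)
    (βf βb : Signal m → ℝ≥0 → ℝ≥0 → ℝ≥0) (p : QuantParams) :
    SymbolicModel (gridStates sys.X p.η) (Signal m) where
  finite_states := (gridStates_finite sys.X_bounded p.η_pos).to_subtype
  init := {q | (q : Fin n → ℝ) ∈ gridStates sys.Xin p.η}
  signals := pwConstSignals sys.U p
  finite_signals := pwConstSignals_finite sys.U_bounded p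
  trans q u q' := u ∈ pwConstSignals sys.U p ∧
    (∀ x ∈ Metric.closedBall (q : Fin n → ℝ) p.η, ∀ t ≤ u.len, sys.fwd x u t ⊆ sys.X) ∧
    (∃ x' ∈ sys.fwd q u u.len, ‖x' - q'‖ ≤ βf u p.η u.len + p.η) ∧
    (∃ x ∈ sys.bwd q' u u.len, ‖x - q‖ ≤ βb u p.η u.len + p.η)
  trans_signal _ _ _ h := h.1

/-- `cl x` is a point of `Q` closest to `x`, for every `x ∈ X`. -/
def ControlSystem.IsClosestPoint {n m : ℕ} (sys : ControlSystem n m) {η : ℝ≥0}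
    (cl : sys.X → gridStates sys.X η) : Prop :=
  ∀ (x : sys.X) (q : gridStates sys.X η),
    ‖(x : Fin n → ℝ) - (cl x : Fin n → ℝ)‖ ≤ ‖(x : Fin n → ℝ) - (q : Fin n → ℝ)‖

open Classical in
/-- The controller `x₀ u₀ … x_k ↦ S (cl x₀, u₀, …, cl x_k)` of a system induced by a symbolic
controller `S`, which is applied to finite runs of the symbolic model only. -/
noncomputable def SymbolicModel.refine {Q A X : Type} (M : SymbolicModel Q A) (cl : X → Q)
    (S : Controller Q A) : Controller X A := fun h =>
  let h' : History Q A := (cl h.1, h.2.map fun a => (a.1, cl a.2))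
  if M.IsFiniteRun h' then S h' else none

/-- `S` solves the symbolic controller synthesis problem. -/
def ControlSystem.SolvesSymbolic {n m : ℕ} {AP : Type*} (sys : ControlSystem n m)
    (βf βb : Signal m → ℝ≥0 → ℝ≥0 → ℝ≥0) (p : QuantParams)
    (cl : sys.X → gridStates sys.X p.η) (P : (Fin n → ℝ) → Set AP) (Φ : PathFormula AP) (ν : ℝ)
    (S : Controller (gridStates sys.X p.η) (Signal m)) : Prop :=
  (∀ h u, S h = some u → u ∈ pwConstSignals sys.U p) ∧
    sys.Solves P Φ ν ((sys.symbolicModel βf βb p).refine cl S)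

/-- `ρ q u q' = (P⁺, P⁻)` under-approximates the propositions that hold, and those that do not
hold, at all times along every finite trajectory over the transition `(q, u, q')`. -/
def ControlSystem.SoundAll {n m : ℕ} {AP : Type*} (sys : ControlSystem n m)
    (βf βb : Signal m → ℝ≥0 → ℝ≥0 → ℝ≥0) (p : QuantParams) (P : (Fin n → ℝ) → Set AP)
    (ρ : gridStates sys.X p.η → Signal m → gridStates sys.X p.η → Set AP × Set AP) : Prop :=
  ∀ q u q', (sys.symbolicModel βf βb p).trans q u q' → ∀ x x' : sys.X,
    (x : Fin n → ℝ) ∈ Metric.closedBall (q : Fin n → ℝ) p.η →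
    (x' : Fin n → ℝ) ∈ Metric.closedBall (q' : Fin n → ℝ) p.η → sys.Step x u x' →
    ∀ σ, sys.IsStepTrajectory x u x' σ →
    ∀ t ≤ u.len, (ρ q u q').1 ⊆ P (σ t) ∧ Disjoint (ρ q u q').2 (P (σ t))

/-- The same at some time along every finite trajectory. -/
def ControlSystem.SoundSome {n m : ℕ} {AP : Type*} (sys : ControlSystem n m)
    (βf βb : Signal m → ℝ≥0 → ℝ≥0 → ℝ≥0) (p : QuantParams) (P : (Fin n → ℝ) → Set AP)
    (ρ : gridStates sys.X p.η → Signal m → gridStates sys.X p.η → Set AP × Set AP) : Prop :=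
  ∀ q u q', (sys.symbolicModel βf βb p).trans q u q' → ∀ x x' : sys.X,
    (x : Fin n → ℝ) ∈ Metric.closedBall (q : Fin n → ℝ) p.η →
    (x' : Fin n → ℝ) ∈ Metric.closedBall (q' : Fin n → ℝ) p.η → sys.Step x u x' →
    ∀ σ, sys.IsStepTrajectory x u x' σ →
    ∃ t ≤ u.len, (ρ q u q').1 ⊆ P (σ t) ∧ Disjoint (ρ q u q').2 (P (σ t))

/-! ## Mean-payoff parity games -/

inductive Player where
  | one
  | two

/-- A mean-payoff parity game: a bipartite directed graph with vertices `V₁ ⊔ V₂` and edges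
`E₁₂ ⊔ E₂₁`, real payoffs, colours and a real threshold. -/
structure MPPG where
  V₁ : Type
  V₂ : Type
  E₁₂ : Type
  E₂₁ : Type
  src₁₂ : E₁₂ → V₁
  tgt₁₂ : E₁₂ → V₂
  src₂₁ : E₂₁ → V₂
  tgt₂₁ : E₂₁ → V₁
  payoff : E₁₂ ⊕ E₂₁ → ℝ
  colour : V₁ ⊕ V₂ → ℕ
  threshold : ℝ

namespace MPPG

abbrev V (G : MPPG) : Type := G.V₁ ⊕ G.V₂

abbrev E (G : MPPG) : Type := G.E₁₂ ⊕ G.E₂₁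

def src (G : MPPG) : G.E → G.V
  | .inl e => .inl (G.src₁₂ e)
  | .inr e => .inr (G.src₂₁ e)

def tgt (G : MPPG) : G.E → G.V
  | .inl e => .inr (G.tgt₁₂ e)
  | .inr e => .inl (G.tgt₂₁ e)

def owner (G : MPPG) : G.V → Player
  | .inl _ => .one
  | .inr _ => .two

/-- A finite play `v₀ e₀ v₁ … v_k` is stored as `v₀` and the list `e₀, …, e_{k-1}`. -/
def IsFinitePlay (G : MPPG) : G.V → List G.E → Prop
  | _, [] => True
  | v, e :: es => G.src e = v ∧ G.IsFinitePlay (G.tgt e) es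

def lastVertex (G : MPPG) : G.V → List G.E → G.V
  | v, [] => v
  | _, e :: es => G.lastVertex (G.tgt e) es

/-- A strategy of player `i`: on the finite plays that end in a vertex of player `i` it chooses an
edge that leaves the last vertex, if there is one, and is undefined otherwise. Its values on other
arguments are irrelevant. -/
structure Strategy (G : MPPG) (i : Player) where
  choose : G.V → List G.E → Option G.E
  src_choose : ∀ v es, G.IsFinitePlay v es → G.owner (G.lastVertex v es) = i →
    ∀ e, choose v es = some e → G.src e = G.lastVertex v es
  defined : ∀ v es, G.IsFinitePlay v es → G.owner (G.lastVertex v es) = i →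
    (∃ e, G.src e = G.lastVertex v es) → (choose v es).isSome

/-- An infinite play `v₀ e₀ v₁ e₁ …`. -/
structure Play (G : MPPG) where
  vertex : ℕ → G.V
  edge : ℕ → G.E
  src_edge : ∀ i, G.src (edge i) = vertex i
  tgt_edge : ∀ i, G.tgt (edge i) = vertex (i + 1)

variable {G : MPPG}

def Play.Consistent {i : Player} (ω : G.Play) (s : G.Strategy i) : Prop :=
  ∀ j, G.owner (ω.vertex j) = i →
    s.choose (ω.vertex 0) ((List.range j).map ω.edge) = some (ω.edge j)

/-- The maximal colour that occurs infinitely often is even. -/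
def Play.ParityWon (ω : G.Play) : Prop :=
  ∃ k, Even k ∧ IsGreatest {c | ∃ᶠ i in Filter.atTop, G.colour (ω.vertex i) = c} k

noncomputable def Play.meanPayoff (ω : G.Play) : EReal :=
  limitAverage fun i => G.payoff (ω.edge i)

/-- `s` is a winning strategy of Player-1 from `v`: against every strategy of Player-2, the play
from `v` that is determined by the two strategies is infinite and is won by Player-1. -/
def Strategy.WinningFrom (s : G.Strategy .one) (v : G.V) : Prop :=
  ∀ s' : G.Strategy .two, ∃ ω : G.Play, ω.vertex 0 = v ∧ ω.Consistent s ∧ ω.Consistent s' ∧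
    ω.ParityWon ∧ (G.threshold : EReal) ≤ ω.meanPayoff

end MPPG

/-! ## The game of a symbolic model and a formula -/

/-- The copies of the base game that make up a game. The Player-1 vertices are the `(q, c)` with
`c : C₁`, the Player-2 vertices the `(q, u, d)` with `d : C₂`. There is an edge from `(q, c)` to
`(q, u, d)` iff `move c q u d`, and the edge of a transition `(q, u, q')` leads from `(q, u, d)` to
`(q', next d q u q')`. Colours are constant on each copy and at most `top`. -/
structure Copies (Q A : Type) where
  C₁ : Type
  C₂ : Type
  finite₁ : Finite C₁
  finite₂ : Finite C₂
  start : C₁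
  move : C₁ → Q → A → C₂ → Prop
  next : C₂ → Q → A → Q → C₁
  top : ℕ
  colour₁ : C₁ → Fin (top + 1)
  colour₂ : C₂ → Fin (top + 1)

namespace Copies

variable {Q A : Type}

/-- Two copies `false` (the initial one) and `true`, with colours `lo` and `hi`. Edges `q → (q, u)`
stay in their copy, and `next` tells in which copy the edge of a transition ends. -/
def twoCopies (top : ℕ) (lo hi : Fin (top + 1)) (next : Bool → Q → A → Q → Bool) : Copies Q A where
  C₁ := Bool
  C₂ := Bool
  finite₁ := inferInstance
  finite₂ := inferInstance
  start := false
  move c _ _ d := d = c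
  next := next
  top := top
  colour₁ c := cond c hi lo
  colour₂ c := cond c hi lo

/-- Until: a new copy `none` of the base game, of colour `1`, is put in front of `T`. A signal `u` is
allowed at `q` in the new copy only if `ok q u`. It leads to one of two Player-2 vertices:
from `inl false` the play stays in the new copy, from `inl true` it moves to the initial copy
of `T`. -/
def untilCopies (ok : Q → A → Prop) (T : Copies Q A) : Copies Q A where
  C₁ := Option T.C₁
  C₂ := Bool ⊕ T.C₂
  finite₁ := have := T.finite₁; inferInstance
  finite₂ := have := T.finite₂; inferInstance
  start := none
  move
    | none, q, u, .inl _ => ok q u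
    | some c, q, u, .inr d => T.move c q u d
    | none, _, _, .inr _ => False
    | some _, _, _, .inl _ => False
  next
    | .inl false, _, _, _ => none
    | .inl true, _, _, _ => some T.start
    | .inr d, q, u, q' => some (T.next d q u q')
  top := T.top + 1
  colour₁
    | none => 1
    | some c => (T.colour₁ c).castSucc
  colour₂
    | .inl _ => 1
    | .inr d => (T.colour₂ d).castSucc

/-- Adds a losing copy `none`, of colour `1`, which replaces the missing edges of `T`: it is entered
with a signal that `T` does not allow, and it is never left. -/
def complete (T : Copies Q A) : Copies Q A where
  C₁ := Option T.C₁
  C₂ := Option T.C₂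
  finite₁ := have := T.finite₁; inferInstance
  finite₂ := have := T.finite₂; inferInstance
  start := some T.start
  move
    | some c, q, u, some d => T.move c q u d
    | some c, q, u, none => ∀ d, ¬ T.move c q u d
    | none, _, _, none => True
    | none, _, _, some _ => False
  next
    | some d, q, u, q' => some (T.next d q u q')
    | none, _, _, _ => none
  top := T.top + 1
  colour₁
    | some c => (T.colour₁ c).castSucc
    | none => 1
  colour₂
    | some d => (T.colour₂ d).castSucc
    | none => 1

/-- The memory of a synchronised product: for each colour `a` of the first component, the largest
colour of the second component seen since the last time `a` was seen. -/
abbrev Memory (a b : ℕ) : Type := Fin (a + 1) → Fin (b + 1)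

/-- The memory after the colours `i` and `j` of the two components. -/
def Memory.update {a b : ℕ} (f : Memory a b) (i : Fin (a + 1)) (j : Fin (b + 1)) : Memory a b :=
  fun i' => if i' = i then 0 else max (f i') j

open Classical in
/-- The colour of a product vertex with colours `i` and `j` and with memory `f`. With
`j' = max (f i) j`, the pairs `(i, j')` are ordered lexicographically, and a pair gets an even
colour iff the parities of `i` and `j'` satisfy the acceptance condition `acc`. -/
noncomputable def pairColour {a b : ℕ} (acc : Prop → Prop → Prop) (f : Memory a b)
    (i : Fin (a + 1)) (j : Fin (b + 1)) : Fin ((2 * ((a + 1) * (b + 1)) - 1) + 1) :=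
  let j' := max (f i) j
  ⟨2 * (i * (b + 1) + j') + (if acc (Even (i : ℕ)) (Even (j' : ℕ)) then 0 else 1), by
    have h1 : (i : ℕ) * (b + 1) + j' + 1 ≤ (a + 1) * (b + 1) := by
      have hi : (i : ℕ) ≤ a := Nat.lt_succ_iff.mp i.2
      have hj : (j' : ℕ) ≤ b := Nat.lt_succ_iff.mp j'.2
      have := Nat.mul_le_mul_right (b + 1) hi
      have h2 : (a + 1) * (b + 1) = a * (b + 1) + (b + 1) := by ring
      omega
    split_ifs <;> omega⟩

/-- The synchronised product of `T` and `T'` with acceptance condition `acc`. -/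
noncomputable def sync (acc : Prop → Prop → Prop) (T T' : Copies Q A) : Copies Q A where
  C₁ := T.C₁ × T'.C₁ × Memory T.top T'.top
  C₂ := T.C₂ × T'.C₂ × Memory T.top T'.top
  finite₁ := have := T.finite₁; have := T'.finite₁; inferInstance
  finite₂ := have := T.finite₂; have := T'.finite₂; inferInstance
  start := (T.start, T'.start, fun _ => 0)
  move c q u d := T.move c.1 q u d.1 ∧ T'.move c.2.1 q u d.2.1 ∧
    d.2.2 = c.2.2.update (T.colour₁ c.1) (T'.colour₁ c.2.1)
  next d q u q' := (T.next d.1 q u q', T'.next d.2.1 q u q',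
    d.2.2.update (T.colour₂ d.1) (T'.colour₂ d.2.1))
  top := 2 * ((T.top + 1) * (T'.top + 1)) - 1
  colour₁ c := pairColour acc c.2.2 (T.colour₁ c.1) (T'.colour₁ c.2.1)
  colour₂ d := pairColour acc d.2.2 (T.colour₂ d.1) (T'.colour₂ d.2.1)

end Copies

open Classical in
/-- The copies of the base game in the game of a path formula. -/
noncomputable def PathFormula.copies {Q A : Type} {AP : Type*} (M : SymbolicModel Q A)
    (ρE ρA : Q → A → Q → Set AP × Set AP) : PathFormula AP → Copies Q A
  | .always φ => Copies.twoCopies 1 0 1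
      fun c q u q' => c || !decide (φ.Certified (ρA q u q') true)
  | .eventually φ => Copies.twoCopies 2 1 2
      fun c q u q' => c || decide (φ.Certified (ρE q u q') true)
  | .alwaysEventually φ => Copies.twoCopies 2 1 2
      fun _ q u q' => decide (φ.Certified (ρE q u q') true)
  | .eventuallyAlways φ => Copies.twoCopies 1 0 1
      fun _ q u q' => !decide (φ.Certified (ρA q u q') true)
  | .until φ Φ => Copies.untilCopies
      (fun q u => ∀ q', M.trans q u q' → φ.Certified (ρA q u q') true) (Φ.copies M ρE ρA)
  | .and Φ Ψ => Copies.sync And (Φ.copies M ρE ρA) (Ψ.copies M ρE ρA)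
  | .or Φ Ψ => Copies.sync Or (Φ.copies M ρE ρA).complete (Ψ.copies M ρE ρA).complete

/-- The mean-payoff parity game with the given copies of the base game. -/
def SymbolicModel.game {Q A : Type} (M : SymbolicModel Q A) (len : A → ℝ) (T : Copies Q A)
    (ν : ℝ) : MPPG where
  V₁ := Q × T.C₁
  V₂ := Q × M.signals × T.C₂
  E₁₂ := {e : (Q × T.C₁) × M.signals × T.C₂ // T.move e.1.2 e.1.1 e.2.1 e.2.2}
  E₂₁ := {e : (Q × M.signals × T.C₂) × Q // M.trans e.1.1 e.1.2.1 e.2}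
  src₁₂ e := e.1.1
  tgt₁₂ e := (e.1.1.1, e.1.2.1, e.1.2.2)
  src₂₁ e := e.1.1
  tgt₂₁ e := (e.1.2, T.next e.1.1.2.2 e.1.1.1 e.1.1.2.1 e.1.2)
  payoff
    | .inl e => len e.1.2.1
    | .inr e => len e.1.1.2.1
  colour
    | .inl v => T.colour₁ v.2
    | .inr v => T.colour₂ v.2.2
  threshold := ν

/-- `G_{Φ,ν}`. -/
noncomputable def gameOf {n m : ℕ} {AP : Type*} (sys : ControlSystem n m)
    (βf βb : Signal m → ℝ≥0 → ℝ≥0 → ℝ≥0) (p : QuantParams)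
    (ρE ρA : gridStates sys.X p.η → Signal m → gridStates sys.X p.η → Set AP × Set AP)
    (Φ : PathFormula AP) (ν : ℝ) : MPPG :=
  (sys.symbolicModel βf βb p).game (fun u => u.len)
    (Φ.copies (sys.symbolicModel βf βb p) ρE ρA) ν

/-! ## Effective computation from a strategy -/

/-- A step function of an oracle algorithm maps an input and the oracle's answers so far either to
the next query or to the output. With the given oracle and on input `x`, the algorithm halts with
output `y`. -/
def OracleOutputs {I Qy An O : Type} (step : I × List An → Qy ⊕ O) (oracle : Qy → An) (x : I)
    (y : O) : Prop :=
  ∃ as : List An,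
    (∀ j (hj : j < as.length), ∃ a, step (x, as.take j) = .inl a ∧ oracle a = as[j]) ∧
    step (x, as) = .inr y

/-- A finite description of a labelled game by natural numbers: the edges (name, source, target),
the Player-1 vertices with their states, the Player-2 vertices with their signals, and the
states with their vertices in the initial copy. -/
abbrev GameTable : Type := List (ℕ × ℕ × ℕ) × List (ℕ × ℕ) × List (ℕ × ℕ) × List (ℕ × ℕ)

/-- A naming of states, signals, vertices and edges by natural numbers, with the resulting finite
description of the game. -/
structure GameNaming {Q A : Type} (M : SymbolicModel Q A) (len : A → ℝ) (T : Copies Q A)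
    (ν : ℝ) where
  state : Q → ℕ
  signal : A → ℕ
  vertex : (M.game len T ν).V → ℕ
  edge : (M.game len T ν).E → ℕ
  state_inj : Function.Injective state
  signal_inj : Set.InjOn signal M.signals
  vertex_inj : Function.Injective vertex
  edge_inj : Function.Injective edge
  table : GameTable
  mem_edges : ∀ a, a ∈ table.1 ↔
    ∃ e, a = (edge e, vertex ((M.game len T ν).src e), vertex ((M.game len T ν).tgt e))
  mem_states : ∀ a, a ∈ table.2.1 ↔ ∃ q c, a = (vertex (.inl (q, c)), state q)
  mem_signals : ∀ a, a ∈ table.2.2.1 ↔ ∃ q u d, a = (vertex (.inr (q, u, d)), signal u)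
  mem_initial : ∀ a, a ∈ table.2.2.2 ↔ ∃ q, a = (state q, vertex (.inl (q, T.start)))

namespace GameNaming

variable {Q A : Type} {M : SymbolicModel Q A} {len : A → ℝ} {T : Copies Q A} {ν : ℝ}

/-- The name of a history of the symbolic model. -/
def history (N : GameNaming M len T ν) (h : History Q A) : ℕ × List (ℕ × ℕ) :=
  (N.state h.1, h.2.map fun a => (N.signal a.1, N.state a.2))

/-- The oracle answers the name of a finite play that ends in a Player-1 vertex with the name of
the edge that `s` chooses (`none` if `s` is undefined there). -/
def Represents (N : GameNaming M len T ν) (oracle : ℕ × List ℕ → Option ℕ)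
    (s : (M.game len T ν).Strategy .one) : Prop :=
  ∀ v es, (M.game len T ν).IsFinitePlay v es →
    (M.game len T ν).owner ((M.game len T ν).lastVertex v es) = .one →
    oracle (N.vertex v, es.map N.edge) = (s.choose v es).map N.edge

end GameNaming

/-!
The synthesised controller plays the strategy `s`: along a finite run of the symbolic model it
simulates the play in which Player-1 follows `s` and Player-2 chooses the observed states, and it
applies the signal of the edge that `s` chooses next (`SymbolicModel.strategyController`).

A step of the system from a state near the grid point `q`, by a signal that the symbolic model
allows at `q`, is matched by a transition to the grid point closest to its end
(`IncrementallyComplete.trans_of_step`), so the runs of the controlled system are shadowed by plays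
that follow `s`. A winning strategy never leads to a vertex without outgoing edges
(`MPPG.Strategy.WinningFrom.exists_play`), hence the current signal has transitions, which together
with the compatibility of the two dynamics rules out deadlocks. Every infinite play that follows a
winning strategy is won, as Player-2 has a strategy that chooses it
(`MPPG.Strategy.WinningFrom.won`). Its mean payoff counts each signal twice, which does not change
the limit average of the lengths (`limitAverage_of_interleave_self`).

That a won play makes the trajectories satisfy `Φ` is shown by induction on `Φ`
(`TimedRun.sat_of_parityAccept`). The two-copy games are immediate. An until-play must leave its
first copy, whose colour is odd; a completed game cannot be won in the losing copy. For the
synchronised products let `A` and `B` be the largest colours that recur in the components. From some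
point on, the remembered colour of a vertex with first colour `A` is at most `B`, and it is `B`
infinitely often because each visit to `B` is remembered until the next visit to `A`; so the largest
recurring colour of the product encodes the pair `(A, B)`
(`Copies.acc_of_parityAccept_pairColour`).

The simulation only looks up edges, states and signals in the finite table of the game and asks the
oracle for the choices of `s`. Its step function replays the answers received so far and is
primitive recursive (`primrec_simulationStep`).
-/

/-! ### Parity acceptance and the memory of synchronised products -/

/-- The largest value that `f` takes infinitely often exists and is even. -/
def ParityAccept (f : ℕ → ℕ) : Prop :=
  ∃ k, Even k ∧ IsGreatest {c | ∃ᶠ i in Filter.atTop, f i = c} k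

/-- A sequence with values in a finite chain has a largest value among those taken infinitely
often, and it eventually stays below that value. -/
theorem exists_recurrent_max {N : ℕ} (a : ℕ → Fin (N + 1)) :
    ∃ A : Fin (N + 1), (∃ᶠ n in Filter.atTop, a n = A) ∧ ∀ᶠ n in Filter.atTop, a n ≤ A := by
  have hne : {c | ∃ᶠ n in Filter.atTop, a n = c}.Nonempty := by
    by_contra h
    rw [Set.not_nonempty_iff_eq_empty, Set.eq_empty_iff_forall_notMem] at h
    have h1 : ∀ᶠ n in Filter.atTop, ∀ c, a n ≠ c :=
      Filter.eventually_all.mpr fun c => Filter.not_frequently.mp (h c)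
    obtain ⟨n, hn⟩ := h1.exists
    exact hn _ rfl
  obtain ⟨A, hA, hmax⟩ := Set.exists_max_image _ id (Set.toFinite _) hne
  refine ⟨A, hA, ?_⟩
  have h1 : ∀ᶠ n in Filter.atTop, ∀ c, A < c → a n ≠ c := by
    refine Filter.eventually_all.mpr fun c => ?_
    by_cases hc : A < c
    · have : ¬ ∃ᶠ n in Filter.atTop, a n = c := fun h => absurd (hmax c h) (not_le.mpr hc)
      exact (Filter.not_frequently.mp this).mono fun n hn _ => hn
    · exact Filter.Eventually.of_forall fun n h => absurd h hc
  filter_upwards [h1] with n hn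
  by_contra hlt
  exact hn _ (not_le.mp hlt) rfl

theorem isGreatest_recurrent {f : ℕ → ℕ} {k : ℕ} (h₁ : ∃ᶠ n in Filter.atTop, f n = k)
    (h₂ : ∀ᶠ n in Filter.atTop, f n ≤ k) :
    IsGreatest {c | ∃ᶠ i in Filter.atTop, f i = c} k := by
  refine ⟨h₁, fun c hc => ?_⟩
  obtain ⟨n, rfl, hn⟩ := (hc.and_eventually h₂).exists
  exact hn

theorem parityAccept_of_recurrent {f : ℕ → ℕ} {k : ℕ} (h₁ : ∃ᶠ n in Filter.atTop, f n = k)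
    (h₂ : ∀ᶠ n in Filter.atTop, f n ≤ k) (hk : Even k) : ParityAccept f :=
  ⟨k, hk, isGreatest_recurrent h₁ h₂⟩

theorem ParityAccept.even_of_recurrent {f : ℕ → ℕ} (h : ParityAccept f) {k : ℕ}
    (h₁ : ∃ᶠ n in Filter.atTop, f n = k) (h₂ : ∀ᶠ n in Filter.atTop, f n ≤ k) : Even k := by
  obtain ⟨l, hl, hg⟩ := h
  rwa [(isGreatest_recurrent h₁ h₂).unique hg]

/-- If `1` is the only colour from some point on, the parity condition fails. -/
theorem ParityAccept.not_eventually_one {f : ℕ → ℕ} (h : ParityAccept f) :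
    ¬ ∀ᶠ n in Filter.atTop, f n = 1 := fun h1 =>
  absurd (h.even_of_recurrent h1.frequently (h1.mono fun _ h => h.le)) (by decide)

/-- Parity acceptance depends only on the tails of a sequence. -/
theorem ParityAccept.shift {f : ℕ → ℕ} (h : ParityAccept f) (k : ℕ) :
    ParityAccept fun n => f (n + k) := by
  obtain ⟨c, hc, hg⟩ := h
  refine ⟨c, hc, ?_⟩
  convert hg using 3 with d
  have := Filter.frequently_map (m := fun n => n + k) (f := Filter.atTop) (P := fun n => f n = d)
  rw [Filter.map_add_atTop_eq_nat] at this
  exact this.symm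

namespace Copies

theorem val_pairColour {a b : ℕ} (acc : Prop → Prop → Prop) (f : Memory a b)
    (i : Fin (a + 1)) (j : Fin (b + 1)) (t : Prop) [Decidable t]
    (ht : t ↔ acc (Even (i : ℕ)) (Even ((max (f i) j : Fin (b + 1)) : ℕ))) :
    (pairColour acc f i j : ℕ) =
      2 * (i * (b + 1) + (max (f i) j : Fin (b + 1))) + (if t then 0 else 1) := by
  classical
  simp only [pairColour, ht]

/-- The colours of a synchronised product compose the parity conditions of its components: if `A`
and `B` are the largest colours that recur in the components, then from some point on the rank of
`(A, B)` bounds all ranks, and it recurs, because every visit to `B` is remembered until the next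
visit to `A`. -/
theorem acc_of_parityAccept_pairColour {A B : ℕ} {acc : Prop → Prop → Prop}
    (a : ℕ → Fin (A + 1)) (b : ℕ → Fin (B + 1)) (f : ℕ → Memory A B)
    (hf : ∀ n, f (n + 1) = (f n).update (a n) (b n))
    (h : ParityAccept fun n => (pairColour acc (f n) (a n) (b n) : ℕ)) :
    acc (ParityAccept fun n => (a n : ℕ)) (ParityAccept fun n => (b n : ℕ)) := by
  classical
  obtain ⟨i, hai, hai'⟩ := exists_recurrent_max a
  obtain ⟨j, hbj, hbj'⟩ := exists_recurrent_max b
  have hpa : (ParityAccept fun n => (a n : ℕ)) = Even (i : ℕ) := by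
    refine propext ⟨fun h => h.even_of_recurrent (hai.mono fun n hn => by rw [hn])
      (hai'.mono fun n hn => hn), fun hi => parityAccept_of_recurrent
      (hai.mono fun n hn => by rw [hn]) (hai'.mono fun n hn => hn) hi⟩
  have hpb : (ParityAccept fun n => (b n : ℕ)) = Even (j : ℕ) := by
    refine propext ⟨fun h => h.even_of_recurrent (hbj.mono fun n hn => by rw [hn])
      (hbj'.mono fun n hn => hn), fun hi => parityAccept_of_recurrent
      (hbj.mono fun n hn => by rw [hn]) (hbj'.mono fun n hn => hn) hi⟩
  rw [hpa, hpb]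
  -- From some point on, the colour recorded for `i` is at most `j`: it is reset at a visit to `i`.
  have hmem : ∀ᶠ n in Filter.atTop, f n i ≤ j := by
    obtain ⟨N, hN⟩ := Filter.eventually_atTop.mp hbj'
    obtain ⟨s, hs, hsi⟩ := Filter.frequently_atTop.mp hai N
    refine Filter.eventually_atTop.mpr ⟨s + 1, fun n hn => ?_⟩
    induction n, hn using Nat.le_induction with
    | base => rw [hf, Memory.update, if_pos hsi.symm]; exact Fin.zero_le _
    | succ n hn ih =>
      rw [hf, Memory.update]
      split_ifs
      · exact Fin.zero_le _
      · exact max_le ih (hN n (by omega))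
  set c : ℕ := 2 * (i * (B + 1) + j) + (if acc (Even (i : ℕ)) (Even (j : ℕ)) then 0 else 1) with hc
  -- A pair of smaller rank has a smaller colour, whatever the parities are.
  have hle : ∀ᶠ n in Filter.atTop, (pairColour acc (f n) (a n) (b n) : ℕ) ≤ c := by
    filter_upwards [hai', hbj', hmem] with n h1 h2 h3
    rw [val_pairColour acc _ _ _ _ Iff.rfl]
    rcases h1.lt_or_eq with h1 | h1
    · have hm : (max (f n (a n)) (b n) : Fin (B + 1)).val ≤ B := Nat.lt_succ_iff.mp (Fin.isLt _)
      have h5 : ((a n : ℕ) + 1) * (B + 1) ≤ i * (B + 1) := Nat.mul_le_mul_right _ h1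
      rw [add_mul] at h5
      split_ifs at hc ⊢ <;> omega
    · rw [h1]
      have hm : max (f n i) (b n) ≤ j := max_le h3 h2
      rcases hm.lt_or_eq with hm | hm
      · have hm' : (max (f n i) (b n) : Fin (B + 1)).val < j := hm
        split_ifs at hc ⊢ <;> omega
      · rw [hm]
  -- After a visit `s` to `j`, the next visit `t` to `i` has the colour of the pair `(i, j)`.
  have hfreq : ∃ᶠ n in Filter.atTop, (pairColour acc (f n) (a n) (b n) : ℕ) = c := by
    obtain ⟨M, hM⟩ := Filter.eventually_atTop.mp (hbj'.and hmem)
    refine Filter.frequently_atTop.mpr fun N => ?_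
    obtain ⟨s, hs, hsj⟩ := Filter.frequently_atTop.mp hbj (max M N)
    have hex : ∃ t, s ≤ t ∧ a t = i := by
      obtain ⟨t, ht, hti⟩ := Filter.frequently_atTop.mp hai s
      exact ⟨t, ht, hti⟩
    obtain ⟨t, ⟨hst, hti⟩, hmin⟩ : ∃ t, (s ≤ t ∧ a t = i) ∧ ∀ m < t, ¬ (s ≤ m ∧ a m = i) :=
      ⟨Nat.find hex, Nat.find_spec hex, fun m hm => Nat.find_min hex hm⟩
    have hsM : M ≤ s := (le_max_left _ _).trans hs
    refine ⟨t, ((le_max_right _ _).trans hs).trans hst, ?_⟩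
    have hrec : ∀ m, s + 1 ≤ m → m ≤ t → j ≤ f m i := by
      intro m hm
      induction m, hm using Nat.le_induction with
      | base =>
        intro hle
        rw [hf, Memory.update, if_neg fun h => hmin s (by omega) ⟨le_rfl, h.symm⟩, hsj]
        exact le_max_right _ _
      | succ m hm ih =>
        intro hle
        rw [hf, Memory.update, if_neg fun h => hmin m (by omega) ⟨by omega, h.symm⟩]
        exact (ih (by omega)).trans (le_max_left _ _)
    have hge : j ≤ max (f t i) (b t) := by
      rcases hst.eq_or_lt with rfl | hlt
      · exact hsj ▸ le_max_right _ _
      · exact (hrec t hlt le_rfl).trans (le_max_left _ _)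
    have heq : max (f t i) (b t) = j :=
      le_antisymm (max_le (hM t (hsM.trans hst)).2 (hM t (hsM.trans hst)).1) hge
    rw [val_pairColour acc _ _ _ _ Iff.rfl, hti, heq]
  have hev := h.even_of_recurrent hfreq hle
  by_contra hno
  rw [hc, if_neg hno, Nat.even_add_one] at hev
  exact hev (even_two_mul _)

end Copies

/-! ### Interleaved sequences -/

/-- The sequence `f 0, g 0, f 1, g 1, …`. -/
def interleave {α : Type*} (f g : ℕ → α) (n : ℕ) : α :=
  if Even n then f (n / 2) else g (n / 2)

section interleave

variable {α β : Type*} (f g : ℕ → α)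

@[simp] theorem interleave_two_mul (i : ℕ) : interleave f g (2 * i) = f i := by
  simp [interleave]

@[simp] theorem interleave_two_mul_add_one (i : ℕ) : interleave f g (2 * i + 1) = g i := by
  have h : (2 * i + 1) / 2 = i := by omega
  simp [interleave, h]

theorem interleave_comp (p : α → β) (n : ℕ) :
    p (interleave f g n) = interleave (p ∘ f) (p ∘ g) n := by
  obtain ⟨i, rfl | rfl⟩ := n.even_or_odd' <;> simp

variable {f g}

theorem eventually_interleave {p : α → Prop} {k : ℕ} (hf : ∀ i ≥ k, p (f i))
    (hg : ∀ i ≥ k, p (g i)) : ∀ᶠ n in Filter.atTop, p (interleave f g n) := by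
  refine Filter.eventually_atTop.mpr ⟨2 * k, fun n hn => ?_⟩
  obtain ⟨i, rfl | rfl⟩ := n.even_or_odd'
  · simpa using hf i (by omega)
  · simpa using hg i (by omega)

end interleave

/-! ### Runs through the copies of the base game -/

namespace Copies

variable {Q A : Type}

/-- The copies `c i`, `d i` visited by a play that starts in the initial copy and follows the
states `q i` and the signals `u i`. -/
structure IsRun (T : Copies Q A) (q : ℕ → Q) (u : ℕ → A) (c : ℕ → T.C₁) (d : ℕ → T.C₂) :
    Prop where
  zero : c 0 = T.start
  move : ∀ i, T.move (c i) (q i) (u i) (d i)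
  next : ∀ i, c (i + 1) = T.next (d i) (q i) (u i) (q (i + 1))

/-- The colours of the vertices of a play that visits the copies `c i` and `d i`. -/
def colourSeq (T : Copies Q A) (c : ℕ → T.C₁) (d : ℕ → T.C₂) : ℕ → ℕ :=
  interleave (fun i => (T.colour₁ (c i) : ℕ)) (fun i => (T.colour₂ (d i) : ℕ))

theorem colourSeq_shift {T : Copies Q A} {c : ℕ → T.C₁} {d : ℕ → T.C₂}
    (h : ParityAccept (T.colourSeq c d)) (k : ℕ) :
    ParityAccept (T.colourSeq (fun i => c (k + i)) fun i => d (k + i)) := by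
  convert h.shift (2 * k) using 2 with n
  obtain ⟨i, rfl | rfl⟩ := n.even_or_odd'
  · rw [show 2 * i + 2 * k = 2 * (k + i) by ring, colourSeq, colourSeq]
    simp
  · rw [show 2 * i + 1 + 2 * k = 2 * (k + i) + 1 by ring, colourSeq, colourSeq]
    simp

/-- A play in a synchronised product that satisfies the parity condition projects to plays in the
components whose parity conditions hold as the acceptance condition says. -/
theorem IsRun.of_sync {acc : Prop → Prop → Prop} {T T' : Copies Q A} {q : ℕ → Q} {u : ℕ → A}
    {c : ℕ → (sync acc T T').C₁} {d : ℕ → (sync acc T T').C₂}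
    (h : (sync acc T T').IsRun q u c d) (hp : ParityAccept ((sync acc T T').colourSeq c d)) :
    T.IsRun q u (fun i => (c i).1) (fun i => (d i).1) ∧
      T'.IsRun q u (fun i => (c i).2.1) (fun i => (d i).2.1) ∧
      acc (ParityAccept (T.colourSeq (fun i => (c i).1) fun i => (d i).1))
        (ParityAccept (T'.colourSeq (fun i => (c i).2.1) fun i => (d i).2.1)) := by
  refine ⟨⟨?_, fun i => (h.move i).1, fun i => ?_⟩, ⟨?_, fun i => (h.move i).2.1, fun i => ?_⟩, ?_⟩
  · rw [h.zero]; rfl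
  · rw [h.next]; rfl
  · rw [h.zero]; rfl
  · rw [h.next]; rfl
  have key := acc_of_parityAccept_pairColour (acc := acc)
    (interleave (fun i => T.colour₁ (c i).1) fun i => T.colour₂ (d i).1)
    (interleave (fun i => T'.colour₁ (c i).2.1) fun i => T'.colour₂ (d i).2.1)
    (interleave (fun i => (c i).2.2) fun i => (d i).2.2) ?_ ?_
  · simp only [interleave_comp _ _ Fin.val] at key
    exact key
  · intro n
    obtain ⟨i, rfl | rfl⟩ := n.even_or_odd'
    · simpa using (h.move i).2.2
    · rw [show 2 * i + 1 + 1 = 2 * (i + 1) by ring]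
      simp only [interleave_two_mul, interleave_two_mul_add_one]
      rw [h.next]; rfl
  · convert hp using 2 with n
    obtain ⟨i, rfl | rfl⟩ := n.even_or_odd'
    · simp only [colourSeq, interleave_two_mul]; rfl
    · simp only [colourSeq, interleave_two_mul_add_one]; rfl

/-- A play in a completed game that satisfies the parity condition never enters the losing copy. -/
theorem IsRun.of_complete {T : Copies Q A} {q : ℕ → Q} {u : ℕ → A} {c : ℕ → T.complete.C₁}
    {d : ℕ → T.complete.C₂} (h : T.complete.IsRun q u c d)
    (hp : ParityAccept (T.complete.colourSeq c d)) :
    ∃ c' d', T.IsRun q u c' d' ∧ ParityAccept (T.colourSeq c' d') := by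
  have hcd : ∀ i, c i = none → d i = none := by
    intro i hi
    have hm := h.move i
    rw [hi] at hm
    rcases hd : d i with _ | y
    · rfl
    · rw [hd] at hm; exact hm.elim
  have hdc : ∀ i, d i = none → c (i + 1) = none := by
    intro i hi
    rw [h.next, hi]; rfl
  have hc : ∀ k, c k ≠ none := by
    intro k hk
    have hall : ∀ i ≥ k, c i = none := fun i hi => by
      induction i, hi using Nat.le_induction with
      | base => exact hk
      | succ i _ ih => exact hdc i (hcd i ih)
    refine hp.not_eventually_one (eventually_interleave (p := (· = 1)) (k := k) ?_ ?_)
    · intro i hi; rw [hall i hi]; simp [complete]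
    · intro i hi; rw [hcd i (hall i hi)]; simp [complete]
  have hd : ∀ k, d k ≠ none := fun k hk => hc _ (hdc k hk)
  choose c' hc' using fun k => Option.ne_none_iff_exists'.mp (hc k)
  choose d' hd' using fun k => Option.ne_none_iff_exists'.mp (hd k)
  refine ⟨c', d', ⟨?_, fun i => ?_, fun i => ?_⟩, ?_⟩
  · have := h.zero
    rw [hc'] at this
    exact Option.some.inj this
  · have := h.move i
    rw [hc', hd'] at this
    exact this
  · have := h.next i
    rw [hc', hd'] at this
    exact Option.some.inj this
  · refine (congrArg ParityAccept (funext fun n => ?_)).mp hp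
    obtain ⟨i, rfl | rfl⟩ := n.even_or_odd'
    · simp only [colourSeq, interleave_two_mul, hc']; rfl
    · simp only [colourSeq, interleave_two_mul_add_one, hd']; rfl

/-- A play in an until-game that satisfies the parity condition leaves the new copy after a positive
number of steps, at all of which the signal is allowed, and then goes on as a play in the old game
that satisfies the parity condition. -/
theorem IsRun.of_until {ok : Q → A → Prop} {T : Copies Q A} {q : ℕ → Q} {u : ℕ → A}
    {c : ℕ → (untilCopies ok T).C₁} {d : ℕ → (untilCopies ok T).C₂}
    (h : (untilCopies ok T).IsRun q u c d)
    (hp : ParityAccept ((untilCopies ok T).colourSeq c d)) :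
    ∃ k, (∀ i < k, ok (q i) (u i)) ∧ 0 < k ∧
      ∃ c' d', T.IsRun (fun i => q (k + i)) (fun i => u (k + i)) c' d' ∧
        ParityAccept (T.colourSeq c' d') := by
  have hnone : ∀ i, c i = none → (∃ b, d i = .inl b) ∧ ok (q i) (u i) := by
    intro i hi
    have hm := h.move i
    rw [hi] at hm
    rcases hd : d i with b | y
    · rw [hd] at hm; exact ⟨⟨b, rfl⟩, hm⟩
    · rw [hd] at hm; exact hm.elim
  have hsome : ∀ i y, c i = some y → ∃ z, d i = .inr z ∧ T.move y (q i) (u i) z ∧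
      c (i + 1) = some (T.next z (q i) (u i) (q (i + 1))) := by
    intro i y hi
    have hm := h.move i
    rw [hi] at hm
    rcases hd : d i with b | z
    · rw [hd] at hm; exact hm.elim
    · rw [hd] at hm
      refine ⟨z, rfl, hm, ?_⟩
      rw [h.next, hd]; rfl
  have hex : ∃ k, c k ≠ none := by
    by_contra hno
    push Not at hno
    refine hp.not_eventually_one (eventually_interleave (p := (· = 1)) (k := 0) ?_ ?_)
    · intro i _; rw [hno i]; simp [untilCopies]
    · intro i _
      obtain ⟨⟨b, hb⟩, -⟩ := hnone i (hno i)
      rw [hb]; simp [untilCopies]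
  obtain ⟨k, hk, hmin⟩ : ∃ k, c k ≠ none ∧ ∀ i < k, c i = none := by
    classical
    exact ⟨Nat.find hex, Nat.find_spec hex, fun i hi => by simpa using Nat.find_min hex hi⟩
  have hk0 : 0 < k := by
    rcases Nat.eq_zero_or_pos k with rfl | h0
    · exact absurd h.zero hk
    · exact h0
  have hstart : c k = some T.start := by
    obtain ⟨j, rfl⟩ : ∃ j, k = j + 1 := ⟨k - 1, by omega⟩
    obtain ⟨⟨b, hb⟩, -⟩ := hnone j (hmin j (by omega))
    have hn := h.next j
    rw [hb] at hn
    cases b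
    · exact absurd hn hk
    · exact hn
  have hex' : ∀ i, ∃ y, c (k + i) = some y := by
    intro i
    induction i with
    | zero => exact ⟨_, hstart⟩
    | succ i ih =>
      obtain ⟨y, hy⟩ := ih
      obtain ⟨z, -, -, hz⟩ := hsome _ y hy
      exact ⟨_, hz⟩
  choose c' hc' using hex'
  choose d' hd' hmv hnx using fun i => hsome _ _ (hc' i)
  refine ⟨k, fun i hi => (hnone i (hmin i hi)).2, hk0, c', d', ⟨?_, hmv, fun i => ?_⟩, ?_⟩
  · exact Option.some.inj ((hc' 0).symm.trans hstart)
  · exact Option.some.inj ((hc' (i + 1)).symm.trans (hnx i))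
  · refine (congrArg ParityAccept (funext fun n => ?_)).mp (colourSeq_shift hp k)
    obtain ⟨i, rfl | rfl⟩ := n.even_or_odd'
    · simp only [colourSeq, interleave_two_mul, hc']; rfl
    · simp only [colourSeq, interleave_two_mul_add_one, hd']; rfl

/-- In a two-copy game the copy changes only at Player-2 vertices. -/
theorem IsRun.eq_of_twoCopies {top : ℕ} {lo hi : Fin (top + 1)} {next : Bool → Q → A → Q → Bool}
    {q : ℕ → Q} {u : ℕ → A} {c d : ℕ → Bool}
    (h : (twoCopies top lo hi next).IsRun q u c d) (i : ℕ) : d i = c i := h.move i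

theorem IsRun.next_of_twoCopies {top : ℕ} {lo hi : Fin (top + 1)}
    {next : Bool → Q → A → Q → Bool} {q : ℕ → Q} {u : ℕ → A} {c d : ℕ → Bool}
    (h : (twoCopies top lo hi next).IsRun q u c d) (i : ℕ) :
    c (i + 1) = next (c i) (q i) (u i) (q (i + 1)) := by
  have := h.next i
  rw [h.eq_of_twoCopies] at this
  exact this

/-- A play that satisfies the parity condition of a two-copy game cannot stay forever in a copy of
colour `1`. -/
theorem IsRun.not_eventually_const {top : ℕ} {lo hi : Fin (top + 1)}
    {next : Bool → Q → A → Q → Bool} {q : ℕ → Q} {u : ℕ → A} {c d : ℕ → Bool}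
    (h : (twoCopies top lo hi next).IsRun q u c d)
    (hp : ParityAccept ((twoCopies top lo hi next).colourSeq c d)) {b : Bool}
    (hb : ((cond b hi lo : Fin (top + 1)) : ℕ) = 1) (k : ℕ) : ∃ i ≥ k, c i ≠ b := by
  by_contra hno
  push Not at hno
  refine hp.not_eventually_one (eventually_interleave (p := (· = 1)) (k := k) (fun i hi => ?_)
    fun i hi => ?_)
  · rw [hno i hi]; exact hb
  · rw [h.eq_of_twoCopies, hno i hi]; exact hb

end Copies

/-! ### From accepted plays to trajectories that satisfy the formula -/

theorem StateFormula.Certified.sat {AP : Type*} {ρ : Set AP × Set AP} {L : Set AP}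
    (h₁ : ρ.1 ⊆ L) (h₂ : Disjoint ρ.2 L) (φ : StateFormula AP) :
    (φ.Certified ρ true → φ.Sat L) ∧ (φ.Certified ρ false → ¬ φ.Sat L) := by
  induction φ with
  | top => simp [Certified, Sat]
  | atom p => exact ⟨fun h => h₁ h, fun h h' => Set.disjoint_left.mp h₂ h h'⟩
  | neg φ ih => exact ⟨ih.2, fun h h' => h' (ih.1 h)⟩
  | or φ ψ ih₁ ih₂ =>
    exact ⟨fun h => h.imp ih₁.1 ih₂.1, fun h h' => h'.elim (ih₁.2 h.1) (ih₂.2 h.2)⟩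

/-- A sequence `q 0, u 0, q 1, …` of transitions of `M`, passed by `σ` between the times `T k`, such
that `σ` satisfies the state formulas certified by `ρA` throughout the transition and those
certified by `ρE` at some time of the transition. -/
structure TimedRun {Q A S : Type} {AP : Type*} (M : SymbolicModel Q A)
    (ρE ρA : Q → A → Q → Set AP × Set AP) (P : S → Set AP) (σ : ℝ≥0 → S) (T : ℕ → ℝ≥0)
    (q : ℕ → Q) (u : ℕ → A) : Prop where
  zero : T 0 = 0
  mono : Monotone T
  unbounded : ∀ t, ∃ k, t < T k
  trans : ∀ k, M.trans (q k) (u k) (q (k + 1))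
  holds_all : ∀ k (φ : StateFormula AP), φ.Certified (ρA (q k) (u k) (q (k + 1))) true →
    ∀ t, T k ≤ t → t ≤ T (k + 1) → φ.Sat (P (σ t))
  holds_some : ∀ k (φ : StateFormula AP), φ.Certified (ρE (q k) (u k) (q (k + 1))) true →
    ∃ t, T k ≤ t ∧ t ≤ T (k + 1) ∧ φ.Sat (P (σ t))

namespace TimedRun

variable {Q A S : Type} {AP : Type*} {M : SymbolicModel Q A}
  {ρE ρA : Q → A → Q → Set AP × Set AP} {P : S → Set AP} {σ : ℝ≥0 → S} {T : ℕ → ℝ≥0}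
  {q : ℕ → Q} {u : ℕ → A}

theorem exists_interval (h : TimedRun M ρE ρA P σ T q u) (t : ℝ≥0) :
    ∃ k, T k ≤ t ∧ t < T (k + 1) := by
  classical
  have hex := h.unbounded t
  obtain ⟨j, hj⟩ : ∃ j, Nat.find hex = j + 1 := by
    refine Nat.exists_eq_succ_of_ne_zero fun h0 => ?_
    have := Nat.find_spec hex
    rw [h0, h.zero] at this
    exact absurd this not_lt_zero
  refine ⟨j, not_lt.mp (Nat.find_min hex (by omega)), hj ▸ Nat.find_spec hex⟩

theorem shift (h : TimedRun M ρE ρA P σ T q u) (k : ℕ) :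
    TimedRun M ρE ρA P (fun t => σ (T k + t)) (fun i => T (k + i) - T k)
      (fun i => q (k + i)) fun i => u (k + i) where
  zero := by simp
  mono i j hij := tsub_le_tsub_right (h.mono (by omega)) _
  unbounded t := by
    obtain ⟨j, hj⟩ := h.unbounded (T k + t)
    refine ⟨j, lt_tsub_iff_left.mpr (hj.trans_le (h.mono (by omega)))⟩
  trans i := h.trans (k + i)
  holds_all i φ hφ t h₁ h₂ := by
    refine h.holds_all (k + i) φ hφ _ (tsub_le_iff_left.mp h₁) ?_
    rwa [le_tsub_iff_left (h.mono (by omega))] at h₂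
  holds_some i φ hφ := by
    obtain ⟨t, h₁, h₂, hs⟩ := h.holds_some (k + i) φ hφ
    have hk : T k ≤ t := (h.mono (by omega)).trans h₁
    refine ⟨t - T k, tsub_le_tsub_right h₁ _, tsub_le_tsub_right h₂ _, ?_⟩
    simpa only [add_tsub_cancel_of_le hk] using hs

/-- A trajectory satisfies `Φ` if the run that it belongs to is accepted in the copies of `Φ`. -/
theorem sat_of_parityAccept (Φ : PathFormula AP) (h : TimedRun M ρE ρA P σ T q u)
    {c : ℕ → (Φ.copies M ρE ρA).C₁} {d : ℕ → (Φ.copies M ρE ρA).C₂}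
    (hr : (Φ.copies M ρE ρA).IsRun q u c d)
    (hp : ParityAccept ((Φ.copies M ρE ρA).colourSeq c d)) : Φ.Sat P σ := by
  classical
  induction Φ generalizing σ T q u
  next φ Φ ih =>
    obtain ⟨k, hok, hk, c', d', hr', hp'⟩ := Copies.IsRun.of_until hr hp
    refine ⟨T k, ih (h.shift k) hr' hp', fun t ht => ?_⟩
    rcases ht.lt_or_eq with ht | rfl
    · obtain ⟨i, hi, hi'⟩ := h.exists_interval t
      have hik : i < k := by
        by_contra hle
        exact absurd ((h.mono (not_lt.mp hle)).trans hi) (not_le.mpr ht)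
      exact h.holds_all i φ (hok i hik _ (h.trans i)) t hi hi'.le
    -- The time `T k` itself is the end of the last transition in the new copy, as `k` is positive.
    · obtain ⟨i, rfl⟩ : ∃ i, k = i + 1 := ⟨k - 1, by omega⟩
      exact h.holds_all i φ (hok i (by omega) _ (h.trans i)) _ (h.mono (by omega)) le_rfl
  next φ =>
    change ∃ t, φ.Sat (P (σ t))
    change ℕ → Bool at c d
    by_contra hno
    have hcert : ∀ k, ¬ φ.Certified (ρE (q k) (u k) (q (k + 1))) true := fun k hk => by
      obtain ⟨t, -, -, ht⟩ := h.holds_some k φ hk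
      exact hno ⟨t, ht⟩
    have hc : ∀ k, c k = false := by
      intro k
      induction k with
      | zero => exact hr.zero
      | succ k ih => rw [Copies.IsRun.next_of_twoCopies hr, ih]; simp [hcert k]
    obtain ⟨i, -, hi⟩ := Copies.IsRun.not_eventually_const hr hp (b := false) rfl 0
    exact hi (hc i)
  next φ =>
    change ℕ → Bool at c d
    have hcert : ∀ k, φ.Certified (ρA (q k) (u k) (q (k + 1))) true := by
      intro k
      by_contra hno
      obtain ⟨i, hi, hne⟩ := Copies.IsRun.not_eventually_const hr hp (b := true) rfl (k + 1)
      refine hne ?_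
      induction i, hi using Nat.le_induction with
      | base => rw [Copies.IsRun.next_of_twoCopies hr]; simp [hno]
      | succ i _ ih =>
        rw [Copies.IsRun.next_of_twoCopies hr]
        by_cases hci : c i = true
        · simp [hci]
        · exact absurd (ih hci) hci
    intro t
    obtain ⟨k, hk, hk'⟩ := h.exists_interval t
    exact h.holds_all k φ (hcert k) t hk hk'.le
  next φ =>
    intro t
    obtain ⟨K, hK⟩ := h.unbounded t
    obtain ⟨i, hi, hne⟩ := Copies.IsRun.not_eventually_const hr hp (b := false) rfl (K + 1)
    obtain ⟨j, rfl⟩ : ∃ j, i = j + 1 := ⟨i - 1, by omega⟩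
    rw [Copies.IsRun.next_of_twoCopies hr] at hne
    obtain ⟨t', h₁, -, hs⟩ := h.holds_some j φ (by simpa using hne)
    exact ⟨t', hK.trans_le ((h.mono (by omega)).trans h₁), hs⟩
  next φ =>
    change ℕ → Bool at c d
    have hev : ∃ K, ∀ i ≥ K, c i = false := by
      by_contra hno
      push Not at hno
      -- Otherwise the odd colour `1` of the second copy is the largest recurring one.
      refine absurd (hp.even_of_recurrent (k := 1) ?_ ?_) (by decide)
      · refine Filter.frequently_atTop.mpr fun N => ?_
        obtain ⟨i, hi, hci⟩ := hno N
        refine ⟨2 * i, by omega, ?_⟩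
        refine (interleave_two_mul _ _ i).trans ?_
        rw [Bool.eq_true_of_not_eq_false hci]
        rfl
      · refine Filter.Eventually.of_forall fun n => ?_
        obtain ⟨i, rfl | rfl⟩ := n.even_or_odd'
        · refine (interleave_two_mul _ _ i).trans_le ?_
          exact Nat.lt_succ_iff.mp (Fin.isLt _)
        · refine (interleave_two_mul_add_one _ _ i).trans_le ?_
          exact Nat.lt_succ_iff.mp (Fin.isLt _)
    obtain ⟨K, hK⟩ := hev
    have hcert : ∀ k ≥ K, φ.Certified (ρA (q k) (u k) (q (k + 1))) true := by
      intro k hk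
      have := hK (k + 1) (by omega)
      rw [Copies.IsRun.next_of_twoCopies hr] at this
      simpa using this
    refine ⟨T K, fun t ht => ?_⟩
    obtain ⟨k, hk, hk'⟩ := h.exists_interval t
    refine h.holds_all k φ (hcert k ?_) t hk hk'.le
    by_contra hlt
    exact absurd (ht.trans (hk'.trans_le (h.mono (by omega)))) (lt_irrefl _)
  next Φ Ψ ih₁ ih₂ =>
    obtain ⟨hr₁, hr₂, hacc⟩ := Copies.IsRun.of_sync hr hp
    rcases hacc with hacc | hacc
    · obtain ⟨c', d', hr', hp'⟩ := Copies.IsRun.of_complete hr₁ hacc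
      exact Or.inl (ih₁ h hr' hp')
    · obtain ⟨c', d', hr', hp'⟩ := Copies.IsRun.of_complete hr₂ hacc
      exact Or.inr (ih₂ h hr' hp')
  next Φ Ψ ih₁ ih₂ =>
    obtain ⟨hr₁, hr₂, hacc⟩ := Copies.IsRun.of_sync hr hp
    exact ⟨ih₁ h hr₁ hacc.1, ih₂ h hr₂ hacc.2⟩

end TimedRun

/-! ### Winning strategies and the plays they generate -/

namespace MPPG

variable {G : MPPG}

theorem isFinitePlay_append {v : G.V} {es es' : List G.E} :
    G.IsFinitePlay v (es ++ es') ↔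
      G.IsFinitePlay v es ∧ G.IsFinitePlay (G.lastVertex v es) es' := by
  induction es generalizing v with
  | nil => simp [IsFinitePlay, lastVertex]
  | cons e es ih => simp [IsFinitePlay, lastVertex, ih, and_assoc]

theorem lastVertex_append {v : G.V} {es es' : List G.E} :
    G.lastVertex v (es ++ es') = G.lastVertex (G.lastVertex v es) es' := by
  induction es generalizing v with
  | nil => rfl
  | cons e es ih => simp [lastVertex, ih]

theorem Play.lastVertex_prefix (ω : G.Play) (j : ℕ) :
    G.lastVertex (ω.vertex 0) ((List.range j).map ω.edge) = ω.vertex j := by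
  induction j with
  | zero => rfl
  | succ j ih =>
    rw [List.range_succ, List.map_append, lastVertex_append, ih]
    exact ω.tgt_edge j

/-- A player can follow any partial recommendation `g` of edges. -/
theorem exists_strategy_of_recommendation (G : MPPG) (i : Player) (g : List G.E → Option G.E) :
    ∃ s : G.Strategy i, ∀ v es e, g es = some e → G.src e = G.lastVertex v es →
      s.choose v es = some e := by
  classical
  refine ⟨⟨fun v es =>
    if h : ∃ e, g es = some e ∧ G.src e = G.lastVertex v es then some h.choose
    else if h : ∃ e, G.src e = G.lastVertex v es then some h.choose else none, ?_, ?_⟩, ?_⟩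
  · intro v es _ _ e he
    split_ifs at he with h h'
    · obtain rfl := Option.some.inj he
      exact h.choose_spec.2
    · obtain rfl := Option.some.inj he
      exact h'.choose_spec
  · intro v es _ _ h
    split_ifs <;> rfl
  · intro v es e he hsrc
    have h : ∃ e, g es = some e ∧ G.src e = G.lastVertex v es := ⟨e, he, hsrc⟩
    exact (dif_pos h).trans (h.choose_spec.1.symm.trans he)

/-- The edges `es` of a finite play from `v` follow the strategy `s` of Player-1. -/
def Strategy.Follows (s : G.Strategy .one) (v : G.V) (es : List G.E) : Prop :=
  G.IsFinitePlay v es ∧ ∀ pre e post, es = pre ++ e :: post →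
    G.owner (G.lastVertex v pre) = .one → s.choose v pre = some e

theorem Strategy.follows_nil (s : G.Strategy .one) (v : G.V) : s.Follows v [] :=
  ⟨trivial, by simp⟩

theorem Strategy.Follows.concat {s : G.Strategy .one} {v : G.V} {es : List G.E}
    (h : s.Follows v es) {e : G.E} (hsrc : G.src e = G.lastVertex v es)
    (he : G.owner (G.lastVertex v es) = .one → s.choose v es = some e) :
    s.Follows v (es ++ [e]) := by
  refine ⟨isFinitePlay_append.mpr ⟨h.1, hsrc, trivial⟩, fun pre f post heq hown => ?_⟩
  rcases List.eq_nil_or_concat post with rfl | ⟨post', f', rfl⟩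
  · obtain ⟨rfl, h2⟩ := List.append_inj' heq rfl
    obtain rfl := (List.cons.inj h2).1
    exact he hown
  · replace heq : es ++ [e] = (pre ++ f :: post') ++ [f'] := by rw [heq]; simp
    exact h.2 pre f post' (List.append_inj' heq rfl).1 hown

/-- From a finite play that follows a winning strategy, an infinite one continues. -/
theorem Strategy.WinningFrom.exists_play {s : G.Strategy .one} {v : G.V} (hs : s.WinningFrom v)
    {es : List G.E} (hes : s.Follows v es) :
    ∃ ω : G.Play, ω.vertex 0 = v ∧ ω.Consistent s ∧
      (List.range es.length).map ω.edge = es := by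
  obtain ⟨s', hs'⟩ := G.exists_strategy_of_recommendation .two fun l => es[l.length]?
  obtain ⟨ω, h0, hω, hω', -⟩ := hs s'
  refine ⟨ω, h0, hω, ?_⟩
  suffices H : ∀ j ≤ es.length, (List.range j).map ω.edge = es.take j by
    rw [H _ le_rfl, List.take_length]
  intro j
  induction j with
  | zero => simp
  | succ j ih =>
    intro hj
    have ih := ih (by omega)
    have hlast : G.lastVertex v (es.take j) = ω.vertex j := by
      rw [← ih, ← h0, ω.lastVertex_prefix]
    have hsplit : es = es.take j ++ es[j] :: es.drop (j + 1) := by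
      rw [← List.drop_eq_getElem_cons, List.take_append_drop]
    suffices hedge : ω.edge j = es[j] by
      rw [List.range_succ, List.map_append, ih, List.map_singleton, hedge,
        List.take_append_getElem]
    rcases hown : G.owner (ω.vertex j) with _ | _
    · have h1 := hω j hown
      rw [ih, h0, hes.2 _ _ _ hsplit (hlast ▸ hown)] at h1
      exact (Option.some.inj h1).symm
    · have h1 := hω' j hown
      have hsrc : G.src es[j] = G.lastVertex v (es.take j) := by
        have := hes.1
        rw [hsplit, isFinitePlay_append] at this
        exact this.2.1
      rw [ih, h0, hs' v (es.take j) es[j] (by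
        rw [List.length_take, min_eq_left (by omega), List.getElem?_eq_getElem]) hsrc] at h1
      exact (Option.some.inj h1).symm

/-- Every infinite play that follows a winning strategy is won, since Player-2 can choose it. -/
theorem Strategy.WinningFrom.won {s : G.Strategy .one} {v : G.V} (hs : s.WinningFrom v)
    (ω : G.Play) (h0 : ω.vertex 0 = v) (hω : ω.Consistent s) :
    ω.ParityWon ∧ (G.threshold : EReal) ≤ ω.meanPayoff := by
  obtain ⟨s', hs'⟩ := G.exists_strategy_of_recommendation .two fun l => some (ω.edge l.length)
  obtain ⟨ω', h0', hω₁, hω₂, hpar, hmean⟩ := hs s'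
  have H : ∀ j, (List.range j).map ω'.edge = (List.range j).map ω.edge := by
    intro j
    induction j with
    | zero => rfl
    | succ j ih =>
      have hlast : ω'.vertex j = ω.vertex j := by
        rw [← ω.lastVertex_prefix, ← ω'.lastVertex_prefix, ih, h0, h0']
      suffices hedge : ω'.edge j = ω.edge j by
        rw [List.range_succ, List.map_append, List.map_append, ih, List.map_singleton,
          List.map_singleton, hedge]
      rcases hown : G.owner (ω.vertex j) with _ | _
      · have h1 := hω₁ j (hlast ▸ hown)
        rw [ih, h0', ← h0, hω j hown] at h1
        exact (Option.some.inj h1).symm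
      · have h1 := hω₂ j (hlast ▸ hown)
        rw [h0', ih, hs' v _ (ω.edge j) (by simp)
          (by rw [ω.src_edge, ← h0, ω.lastVertex_prefix])] at h1
        exact (Option.some.inj h1).symm
  have hedge : ω'.edge = ω.edge := by
    funext j
    have := congrArg (fun l => l[j]?) (H (j + 1))
    simpa using this
  have hvertex : ω'.vertex = ω.vertex := by
    funext j
    rw [← ω.src_edge, ← ω'.src_edge, hedge]
  obtain rfl : ω' = ω := by
    cases ω; cases ω'
    simp_all
  exact ⟨hpar, hmean⟩

end MPPG

/-! ### Histories -/

/-- The last state of the finite sequence `x u₀ x₁ …`. -/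
def pathEnd {S A : Type} (x : S) (l : List (A × S)) : S := l.foldl (fun _ a => a.2) x

@[simp] theorem pathEnd_concat {S A : Type} (x : S) (l : List (A × S)) (a : A × S) :
    pathEnd x (l ++ [a]) = a.2 := by simp [pathEnd]

theorem isPath_concat {S A : Type} {step : S → A → S → Prop} {x : S} {l : List (A × S)}
    {a : A × S} :
    IsPath step x (l ++ [a]) ↔ IsPath step x l ∧ step (pathEnd x l) a.1 a.2 := by
  induction l generalizing x with
  | nil => simp [IsPath, pathEnd]
  | cons b l ih =>
    rw [List.cons_append, IsPath, IsPath, ih, and_assoc]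
    rfl

theorem historyOf_succ {S A : Type} (x : ℕ → S) (u : ℕ → A) (k : ℕ) :
    historyOf x u (k + 1) = ((historyOf x u k).1, (historyOf x u k).2 ++ [(u k, x (k + 1))]) := by
  simp [historyOf, List.range_succ]

theorem pathEnd_historyOf {S A : Type} (x : ℕ → S) (u : ℕ → A) (k : ℕ) :
    pathEnd (historyOf x u k).1 (historyOf x u k).2 = x k := by
  cases k with
  | zero => rfl
  | succ k => rw [historyOf_succ]; simp

/-- A class of histories in which every history can be prolonged by a step contains all long
prefixes of some infinite prolongation of each of its members. -/
theorem exists_infinite_extension {S A : Type} (C : History S A → Prop)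
    (hC : ∀ h, C h → ∃ a, C (h.1, h.2 ++ [a])) (h : History S A) (hh : C h) :
    ∃ x u, historyOf x u h.2.length = h ∧ ∀ k, C (historyOf x u (h.2.length + k)) := by
  choose nxt hnxt using fun h : {h // C h} => hC h.1 h.2
  let H : ℕ → {h // C h} := fun k => Nat.rec ⟨h, hh⟩ (fun _ g => ⟨_, hnxt g⟩) k
  have hsucc : ∀ k, (H (k + 1)).1 = ((H k).1.1, (H k).1.2 ++ [nxt (H k)]) := fun k => rfl
  have hfst : ∀ k, (H k).1.1 = h.1 := by
    intro k
    induction k with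
    | zero => rfl
    | succ k ih => rw [hsucc]; exact ih
  have hlen : ∀ k, (H k).1.2.length = h.2.length + k := by
    intro k
    induction k with
    | zero => rfl
    | succ k ih => rw [hsucc, List.length_append, ih]; rfl
  have hget : ∀ i j k, i < h.2.length + j → j ≤ k → (H k).1.2[i]? = (H j).1.2[i]? := by
    intro i j k hi hjk
    induction k, hjk using Nat.le_induction with
    | base => rfl
    | succ k hk ih =>
      rw [hsucc, ← ih]
      exact List.getElem?_append_left (by rw [hlen]; omega)
  have ha : ∀ i, ∃ a, (H (i + 1)).1.2[i]? = some a := fun i =>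
    ⟨_, List.getElem?_eq_getElem (by have := hlen (i + 1); omega)⟩
  choose a ha using ha
  have hist : ∀ k, historyOf (fun i => Nat.casesOn i h.1 fun i => (a i).2) (fun i => (a i).1)
      (h.2.length + k) = (H k).1 := by
    intro k
    refine Prod.ext (hfst k).symm (List.ext_getElem? fun i => ?_)
    by_cases hi : i < h.2.length + k
    · have h1 : (H k).1.2[i]? = some (a i) := by
        rw [← ha i]
        rcases le_total k (i + 1) with hk | hk
        · exact (hget i k (i + 1) hi hk).symm
        · exact hget i (i + 1) k (by omega) hk
      rw [h1]
      simp [historyOf, hi]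
    · rw [List.getElem?_eq_none (by simp [historyOf]; omega),
        List.getElem?_eq_none (by rw [hlen]; omega)]
  exact ⟨_, _, hist 0, fun k => by rw [hist]; exact (H k).2⟩

/-! ### Simulation of a strategy along a history -/

namespace SymbolicModel

variable {Q A : Type} {M : SymbolicModel Q A} {len : A → ℝ} {T : Copies Q A} {ν : ℝ}

open Classical in
/-- The edges `es` of a play from `v`, prolonged by the choice of the strategy `s` and by the edge
of the transition to `a.2`, provided that `s` chooses the signal `a.1`. -/
noncomputable def extendPlay (s : (M.game len T ν).Strategy .one) (v : (M.game len T ν).V)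
    (es : List (M.game len T ν).E) (a : A × Q) : Option (List (M.game len T ν).E) :=
  match s.choose v es with
  | some (.inl e) =>
    if h : (e.1.2.1 : A) = a.1 ∧ M.trans e.1.1.1 e.1.2.1 a.2 then
      some (es ++ [.inl e, .inr ⟨((e.1.1.1, e.1.2.1, e.1.2.2), a.2), h.2⟩])
    else none
  | _ => none

/-- The edges of the play from `v` in which Player-1 follows `s` and the signals and the moves of
Player-2 are those of the history. -/
noncomputable def simulate (s : (M.game len T ν).Strategy .one) (v : (M.game len T ν).V)
    (l : List (A × Q)) : Option (List (M.game len T ν).E) :=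
  l.foldlM (extendPlay s v) []

/-- The signal of an edge of Player-1. -/
def edgeSignal : (M.game len T ν).E → Option A
  | .inl e => some e.1.2.1
  | .inr _ => none

/-- The symbolic controller that simulates `s` along the history, from the initial copy, and applies
the signal that `s` chooses at the end. -/
noncomputable def strategyController (s : (M.game len T ν).Strategy .one) : Controller Q A :=
  fun h => (simulate s (.inl (h.1, T.start)) h.2).bind fun es =>
    (s.choose (.inl (h.1, T.start)) es).bind edgeSignal

variable {s : (M.game len T ν).Strategy .one}

theorem extendPlay_eq_some {v : (M.game len T ν).V} {es es' : List (M.game len T ν).E}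
    {a : A × Q} : extendPlay s v es a = some es' ↔
      ∃ (e : (M.game len T ν).E₁₂) (h : M.trans e.1.1.1 e.1.2.1 a.2),
        s.choose v es = some (.inl e) ∧ (e.1.2.1 : A) = a.1 ∧
        es' = es ++ [.inl e, .inr ⟨((e.1.1.1, e.1.2.1, e.1.2.2), a.2), h⟩] := by
  rw [extendPlay]
  split
  · next e he =>
    constructor
    · intro h
      split_ifs at h with h'
      exact ⟨e, h'.2, he, h'.1, (Option.some.inj h).symm⟩
    · rintro ⟨e', h', he', hu, rfl⟩
      obtain rfl := Sum.inl.inj (Option.some.inj (he.symm.trans he'))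
      rw [dif_pos ⟨hu, h'⟩]
  · next hno =>
    refine ⟨fun h => by simp at h, ?_⟩
    rintro ⟨e, -, he, -⟩
    exact absurd he (hno e)

theorem simulate_concat (v : (M.game len T ν).V) (l : List (A × Q)) (a : A × Q) :
    simulate s v (l ++ [a]) = (simulate s v l).bind fun es => extendPlay s v es a := by
  rw [simulate, simulate, List.foldlM_append]
  simp [Option.bind_eq_bind]

theorem edgeSignal_eq_some {e : (M.game len T ν).E} {u : A} :
    edgeSignal e = some u ↔ ∃ e', e = .inl e' ∧ (e'.1.2.1 : A) = u := by
  cases e with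
  | inl e => simp [edgeSignal]
  | inr e => simp [edgeSignal]

theorem src_eq_inl {e : (M.game len T ν).E} {q : Q} {c : T.C₁}
    (h : (M.game len T ν).src e = .inl (q, c)) : ∃ e', e = .inl e' ∧ e'.1.1 = (q, c) := by
  cases e with
  | inl e => exact ⟨e, rfl, Sum.inl.inj h⟩
  | inr e => exact absurd h Sum.inr_ne_inl

theorem simulate_follows {q : Q} {c : T.C₁} {l : List (A × Q)} {es : List (M.game len T ν).E}
    (h : simulate s (.inl (q, c)) l = some es) :
    s.Follows (.inl (q, c)) es ∧
      ∃ c', (M.game len T ν).lastVertex (.inl (q, c)) es = .inl (pathEnd q l, c') := by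
  induction l using List.reverseRecOn generalizing es with
  | nil =>
    obtain rfl : [] = es := Option.some.inj h
    exact ⟨s.follows_nil _, c, rfl⟩
  | append_singleton l a ih =>
    rw [simulate_concat, Option.bind_eq_some_iff] at h
    obtain ⟨es₀, h₀, h⟩ := h
    obtain ⟨hf, c', hlast⟩ := ih h₀
    obtain ⟨e, htr, he, hu, rfl⟩ := extendPlay_eq_some.mp h
    have hsrc := s.src_choose _ _ hf.1 (by rw [hlast]; rfl) _ he
    have hf₁ := hf.concat hsrc fun _ => he
    have hl₁ : (M.game len T ν).lastVertex (.inl (q, c)) (es₀ ++ [.inl e]) =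
        .inr (e.1.1.1, e.1.2.1, e.1.2.2) := by
      rw [MPPG.lastVertex_append]; rfl
    have hf₂ := hf₁.concat (e := .inr ⟨((e.1.1.1, e.1.2.1, e.1.2.2), a.2), htr⟩) hl₁.symm
      fun hown => by rw [hl₁] at hown; exact absurd hown (by simp [MPPG.owner])
    rw [List.append_assoc] at hf₂
    refine ⟨hf₂, T.next e.1.2.2 e.1.1.1 e.1.2.1 a.2, ?_⟩
    rw [MPPG.lastVertex_append, pathEnd_concat]
    rfl

/-- As long as a winning strategy can be simulated, it goes on to choose signals, and these have
transitions from the current state. -/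
theorem exists_choice_of_simulate {q : Q} {c : T.C₁} {l : List (A × Q)}
    {es : List (M.game len T ν).E} (hs : s.WinningFrom (.inl (q, c)))
    (h : simulate s (.inl (q, c)) l = some es) :
    ∃ e : (M.game len T ν).E₁₂, s.choose (.inl (q, c)) es = some (.inl e) ∧
      e.1.1.1 = pathEnd q l ∧ ∃ q', M.trans (pathEnd q l) e.1.2.1 q' := by
  obtain ⟨hf, c', hlast⟩ := simulate_follows h
  obtain ⟨ω, h0, hω, hpre⟩ := hs.exists_play hf
  have hv : ω.vertex es.length = .inl (pathEnd q l, c') := by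
    rw [← ω.lastVertex_prefix, hpre, h0, hlast]
  have hch := hω es.length (by rw [hv]; rfl)
  rw [hpre, h0] at hch
  obtain ⟨e, he, hsrc⟩ := src_eq_inl ((ω.src_edge es.length).trans hv)
  rw [he] at hch
  have hq : e.1.1.1 = pathEnd q l := by rw [hsrc]
  refine ⟨e, hch, hq, ?_⟩
  have htgt := ω.tgt_edge es.length
  rw [he, ← ω.src_edge] at htgt
  rcases hf' : ω.edge (es.length + 1) with f | f
  · rw [hf'] at htgt
    exact absurd htgt Sum.inr_ne_inl
  · rw [hf'] at htgt
    have h1 : (e.1.1.1, e.1.2.1, e.1.2.2) = f.1.1 := Sum.inr.inj htgt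
    refine ⟨f.1.2, ?_⟩
    have := f.2
    rw [← h1, hq] at this
    exact this

theorem strategyController_eq_some {h : History Q A} {u : A} :
    strategyController s h = some u ↔ ∃ (es : List (M.game len T ν).E) (e : (M.game len T ν).E₁₂),
      simulate s (.inl (h.1, T.start)) h.2 = some es ∧
      s.choose (.inl (h.1, T.start)) es = some (.inl e) ∧ (e.1.2.1 : A) = u := by
  simp only [strategyController, Option.bind_eq_some_iff, edgeSignal_eq_some]
  constructor
  · rintro ⟨es, hes, e, he, e', rfl, hu⟩
    exact ⟨es, e', hes, he, hu⟩
  · rintro ⟨es, e, hes, he, hu⟩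
    exact ⟨es, hes, _, he, e, rfl, hu⟩

/-- An infinite run of the symbolic model along which the controller of a winning strategy is
followed is accepted in the copies and has a sufficient mean payoff. -/
theorem accepted_of_strategyController {q : ℕ → Q} {u : ℕ → A}
    (hs : s.WinningFrom (.inl (q 0, T.start))) (htr : ∀ i, M.trans (q i) (u i) (q (i + 1)))
    (hS : ∀ i, strategyController s (historyOf q u i) = some (u i)) :
    (∃ c d, T.IsRun q u c d ∧ ParityAccept (T.colourSeq c d)) ∧
      (ν : EReal) ≤ limitAverage (interleave (fun i => len (u i)) fun i => len (u i)) := by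
  choose es e hes he hu using fun i => strategyController_eq_some.mp (hS i)
  have hq : ∀ i, (e i).1.1.1 = q i := by
    intro i
    obtain ⟨hf, c', hlast⟩ := simulate_follows (hes i)
    have := s.src_choose _ _ hf.1 (by rw [hlast]; rfl) _ (he i)
    rw [hlast, pathEnd_historyOf] at this
    exact congrArg Prod.fst (Sum.inl.inj this)
  have htr' : ∀ i, M.trans (e i).1.1.1 (e i).1.2.1 (q (i + 1)) := fun i => by
    rw [hq, hu]; exact htr i
  let f : ℕ → (M.game len T ν).E₂₁ := fun i =>
    ⟨(((e i).1.1.1, (e i).1.2.1, (e i).1.2.2), q (i + 1)), htr' i⟩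
  have hsucc : ∀ i, es (i + 1) = es i ++ [.inl (e i), .inr (f i)] := by
    intro i
    have h1 := hes (i + 1)
    rw [historyOf_succ, simulate_concat] at h1
    change (simulate s (.inl (q 0, T.start)) (historyOf q u i).2).bind _ = _ at h1
    have h2 : simulate s (.inl (q 0, T.start)) (historyOf q u i).2 = some (es i) := hes i
    rw [h2, Option.bind_some, extendPlay_eq_some] at h1
    obtain ⟨e', _, he', _, h4⟩ := h1
    obtain rfl := Sum.inl.inj (Option.some.inj (he'.symm.trans (he i)))
    exact h4
  have hzero : es 0 = [] := (Option.some.inj (hes 0)).symm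
  -- The play starts in the initial copy and its Player-1 vertices are the sources of the `e i`.
  have hsrc : ∀ i, (M.game len T ν).lastVertex (.inl (q 0, T.start)) (es i) =
      .inl (e i).1.1 := by
    intro i
    obtain ⟨hf, c', hlast⟩ := simulate_follows (hes i)
    exact (s.src_choose _ _ hf.1 (by rw [hlast]; rfl) _ (he i)).symm
  have hstart : (e 0).1.1 = (q 0, T.start) := by
    have := hsrc 0
    rw [hzero] at this
    exact (Sum.inl.inj this).symm
  have hnext : ∀ i, (e (i + 1)).1.1 =
      (q (i + 1), T.next (e i).1.2.2 (e i).1.1.1 (e i).1.2.1 (q (i + 1))) := by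
    intro i
    have := hsrc (i + 1)
    rw [hsucc, MPPG.lastVertex_append] at this
    exact (Sum.inl.inj this).symm
  let edge : ℕ → (M.game len T ν).E := interleave (fun i => .inl (e i)) fun i => .inr (f i)
  let ω : (M.game len T ν).Play :=
    { vertex := fun n => (M.game len T ν).src (edge n)
      edge := edge
      src_edge := fun _ => rfl
      tgt_edge := fun n => by
        obtain ⟨i, rfl | rfl⟩ := n.even_or_odd'
        · simp only [edge, interleave_two_mul, interleave_two_mul_add_one]
          rfl
        · rw [show 2 * i + 1 + 1 = 2 * (i + 1) by ring]
          simp only [edge, interleave_two_mul, interleave_two_mul_add_one]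
          exact congrArg Sum.inl (hnext i).symm }
  have hω0 : ω.vertex 0 = .inl (q 0, T.start) := congrArg Sum.inl hstart
  have hpre : ∀ i, (List.range (2 * i)).map ω.edge = es i := by
    intro i
    induction i with
    | zero => exact hzero.symm
    | succ i ih =>
      rw [show 2 * (i + 1) = 2 * i + 1 + 1 by ring, List.range_succ, List.range_succ,
        List.map_append, List.map_append, ih, hsucc]
      simp [ω, edge]
  have hcons : ω.Consistent s := by
    intro n hown
    obtain ⟨i, rfl | rfl⟩ := n.even_or_odd'
    · rw [hpre, hω0]
      simp only [ω, edge, interleave_two_mul]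
      exact he i
    · simp [ω, edge, MPPG.src, MPPG.owner] at hown
  obtain ⟨hpar, hmean⟩ := hs.won ω hω0 hcons
  refine ⟨⟨fun i => (e i).1.1.2, fun i => (e i).1.2.2, ⟨congrArg Prod.snd hstart, fun i => ?_,
    fun i => ?_⟩, ?_⟩, ?_⟩
  · have := (e i).2
    rw [hq, hu] at this
    exact this
  · have := congrArg Prod.snd (hnext i)
    rw [hq, hu] at this
    exact this
  · refine (congrArg ParityAccept (funext fun n => ?_)).mp hpar
    obtain ⟨i, rfl | rfl⟩ := n.even_or_odd'
    · simp only [Copies.colourSeq, ω, edge, interleave_two_mul]; rfl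
    · simp only [Copies.colourSeq, ω, edge, interleave_two_mul_add_one]; rfl
  · refine hmean.trans_eq (congrArg limitAverage (funext fun n => ?_))
    obtain ⟨i, rfl | rfl⟩ := n.even_or_odd'
    · simp only [ω, edge, interleave_two_mul]; rw [← hu]; rfl
    · simp only [ω, edge, interleave_two_mul_add_one]; rw [← hu]; rfl

end SymbolicModel

/-! ### The oracle algorithm -/

/-- The name of the signal of the vertex in which the edge named `e` ends. -/
def GameTable.targetSignal (t : GameTable) (e : ℕ) : Option ℕ :=
  (t.1.lookup e).bind fun a => t.2.2.1.lookup a.2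

/-- The name of the edge `b` if it leads from the vertex `w` to a vertex with state `q`. -/
def GameTable.edgeName (t : GameTable) (w q : ℕ) (b : ℕ × ℕ × ℕ) : Option ℕ :=
  if b.2.1 = w ∧ t.2.1.lookup b.2.2 = some q then some b.1 else none

/-- The name of an edge to a vertex with state `q` from the vertex in which the edge `e` ends. -/
def GameTable.reply (t : GameTable) (e q : ℕ) : Option ℕ :=
  (t.1.lookup e).bind fun a => (t.1.filterMap (t.edgeName a.2 q)).head?

/-- A state of the algorithm: the remaining history with the edges of the play simulated so far, or
the output. -/
abbrev SimState : Type := (List (ℕ × ℕ) × List ℕ) ⊕ Option ℕ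

/-- The effect of the edge `e` chosen by the strategy: at the end of the history the algorithm
outputs its signal; before, it appends this edge and the edge of the next transition to the play,
provided that the signal is that of the history. The default `0` does not occur for a history that
is a run of the symbolic model, because the table lists the edges of all transitions. -/
def GameTable.advanceEdge (t : GameTable) (p : List (ℕ × ℕ) × List ℕ) (e : ℕ) : SimState :=
  List.casesOn p.1 (.inr (t.targetSignal e)) fun a r =>
    if t.targetSignal e = some a.1 then .inl (r, p.2 ++ [e, (t.reply e a.2).getD 0]) else .inr none

/-- The effect of an answer of the oracle. -/
def GameTable.advance (t : GameTable) (st : SimState) (ans : Option ℕ) : SimState :=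
  Sum.casesOn st (fun p => Option.casesOn ans (.inr none) (t.advanceEdge p)) .inr

/-- The step function of the algorithm, which replays the simulation with the answers so far. The
first component of a query is the vertex of the first state in the initial copy. -/
def simulationStep (i : (GameTable × ℕ × List (ℕ × ℕ)) × List (Option ℕ)) :
    (ℕ × List ℕ) ⊕ Option ℕ :=
  Sum.casesOn (i.2.foldl i.1.1.advance (.inl (i.1.2.2, [])))
    (fun p => .inl ((i.1.1.2.2.2.lookup i.1.2.1).getD 0, p.2)) .inr

section Primrec

open Primrec

theorem primrec_targetSignal : Primrec₂ GameTable.targetSignal := by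
  refine option_bind (listLookup.comp snd (fst.comp fst)) ?_
  exact listLookup.comp (snd.comp snd) (fst.comp (snd.comp (snd.comp (fst.comp fst))))

theorem primrec_edgeName : Primrec₂ fun (i : GameTable × ℕ × ℕ) (b : ℕ × ℕ × ℕ) =>
    i.1.edgeName i.2.1 i.2.2 b := by
  have hw : Primrec fun i : (GameTable × ℕ × ℕ) × ℕ × ℕ × ℕ => i.1.2.1 :=
    fst.comp (snd.comp fst)
  have hq : Primrec fun i : (GameTable × ℕ × ℕ) × ℕ × ℕ × ℕ => i.1.2.2 :=
    snd.comp (snd.comp fst)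
  have ht : Primrec fun i : (GameTable × ℕ × ℕ) × ℕ × ℕ × ℕ => i.1.1.2.1 :=
    fst.comp (snd.comp (fst.comp fst))
  refine ite (PrimrecPred.and ?_ ?_) (option_some.comp (fst.comp snd)) (const none)
  · exact Primrec.eq.comp (fst.comp (snd.comp snd)) hw
  · exact Primrec.eq.comp (listLookup.comp (snd.comp (snd.comp snd)) ht) (option_some.comp hq)

theorem primrec_reply : Primrec fun i : GameTable × ℕ × ℕ => i.1.reply i.2.1 i.2.2 := by
  have hedges : Primrec fun i : GameTable × ℕ × ℕ => i.1.1 := fst.comp fst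
  have hfind : Primrec fun i : GameTable × ℕ × ℕ =>
      (i.1.1.filterMap fun b => i.1.edgeName i.2.1 i.2.2 b).head? :=
    list_head?.comp (listFilterMap hedges primrec_edgeName)
  have hargs : Primrec fun i : (GameTable × ℕ × ℕ) × ℕ × ℕ => (i.1.1, i.2.2, i.1.2.2) :=
    (fst.comp fst).pair ((snd.comp snd).pair (snd.comp (snd.comp fst)))
  exact option_bind (listLookup.comp (fst.comp snd) hedges) (hfind.comp hargs)

theorem primrec_advanceEdge : Primrec fun i : GameTable × (List (ℕ × ℕ) × List ℕ) × ℕ =>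
    i.1.advanceEdge i.2.1 i.2.2 := by
  have hl : Primrec fun i : GameTable × (List (ℕ × ℕ) × List ℕ) × ℕ => i.2.1.1 :=
    fst.comp (fst.comp snd)
  have hsig : Primrec fun i : GameTable × (List (ℕ × ℕ) × List ℕ) × ℕ => i.1.targetSignal i.2.2 :=
    primrec_targetSignal.comp fst (snd.comp snd)
  have he : Primrec fun i : (GameTable × (List (ℕ × ℕ) × List ℕ) × ℕ) × (ℕ × ℕ) × List (ℕ × ℕ) =>
      i.1.2.2 := snd.comp (snd.comp fst)
  have hes : Primrec fun i : (GameTable × (List (ℕ × ℕ) × List ℕ) × ℕ) × (ℕ × ℕ) × List (ℕ × ℕ) =>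
      i.1.2.1.2 := snd.comp (fst.comp (snd.comp fst))
  have hreply : Primrec fun i : (GameTable × (List (ℕ × ℕ) × List ℕ) × ℕ) × (ℕ × ℕ) ×
      List (ℕ × ℕ) => (i.1.1.reply i.1.2.2 i.2.1.2).getD 0 :=
    option_getD.comp (primrec_reply.comp
      ((fst.comp fst).pair (he.pair (snd.comp (fst.comp snd))))) (const 0)
  have hplay : Primrec fun i : (GameTable × (List (ℕ × ℕ) × List ℕ) × ℕ) × (ℕ × ℕ) ×
      List (ℕ × ℕ) => i.1.2.1.2 ++ [i.1.2.2, (i.1.1.reply i.1.2.2 i.2.1.2).getD 0] :=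
    list_append.comp hes (list_cons.comp he (list_cons.comp hreply (const [])))
  have hstep : Primrec₂ fun (i : GameTable × (List (ℕ × ℕ) × List ℕ) × ℕ)
      (b : (ℕ × ℕ) × List (ℕ × ℕ)) =>
      if i.1.targetSignal i.2.2 = some b.1.1 then
        (Sum.inl (b.2, i.2.1.2 ++ [i.2.2, (i.1.reply i.2.2 b.1.2).getD 0]) : SimState)
      else Sum.inr none :=
    ite (Primrec.eq.comp (hsig.comp fst) (option_some.comp (fst.comp (fst.comp snd))))
      (sumInl.comp ((snd.comp snd).pair hplay)) (const (Sum.inr none))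
  exact list_casesOn hl (sumInr.comp hsig) hstep

theorem primrec_advance :
    Primrec fun i : GameTable × SimState × Option ℕ => i.1.advance i.2.1 i.2.2 := by
  have hargs : Primrec fun i : ((GameTable × SimState × Option ℕ) × List (ℕ × ℕ) × List ℕ) × ℕ =>
      (i.1.1.1, i.1.2, i.2) :=
    (fst.comp (fst.comp fst)).pair ((snd.comp fst).pair snd)
  have hedge : Primrec₂ fun (i : (GameTable × SimState × Option ℕ) × List (ℕ × ℕ) × List ℕ)
      (e : ℕ) => i.1.1.advanceEdge i.2 e := primrec_advanceEdge.comp hargs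
  have hans : Primrec₂ fun (i : GameTable × SimState × Option ℕ) (p : List (ℕ × ℕ) × List ℕ) =>
      (Option.casesOn i.2.2 (Sum.inr none) (i.1.advanceEdge p) : SimState) :=
    option_casesOn (snd.comp (snd.comp fst)) (const (Sum.inr none)) hedge
  exact sumCasesOn (fst.comp snd) hans (sumInr.comp snd)

theorem primrec_simulationStep : Primrec simulationStep := by
  have hfold : Primrec fun i : (GameTable × ℕ × List (ℕ × ℕ)) × List (Option ℕ) =>
      i.2.foldl i.1.1.advance (Sum.inl (i.1.2.2, [])) := by
    refine list_foldl (h := fun (i : (GameTable × ℕ × List (ℕ × ℕ)) × List (Option ℕ))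
      (p : SimState × Option ℕ) => i.1.1.advance p.1 p.2) snd ?_ ?_
    · exact sumInl.comp ((snd.comp (snd.comp fst)).pair (const []))
    · exact primrec_advance.comp ((fst.comp (fst.comp fst)).pair
        ((fst.comp snd).pair (snd.comp snd)))
  have hstart : Primrec fun i : (GameTable × ℕ × List (ℕ × ℕ)) × List (Option ℕ) =>
      (i.1.1.2.2.2.lookup i.1.2.1).getD 0 :=
    option_getD.comp (listLookup.comp (fst.comp (snd.comp fst))
      (snd.comp (snd.comp (snd.comp (fst.comp fst))))) (const 0)
  exact sumCasesOn hfold (sumInl.comp ((hstart.comp fst).pair (snd.comp snd))) (sumInr.comp snd)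

end Primrec

theorem List.lookup_eq_some_of_unique {α β : Type*} [DecidableEq α] {l : List (α × β)} {a : α}
    {b : β} (h : (a, b) ∈ l) (huniq : ∀ b', (a, b') ∈ l → b' = b) : l.lookup a = some b := by
  induction l with
  | nil => simp at h
  | cons c l ih =>
    obtain ⟨a', b'⟩ := c
    rw [List.lookup_cons]
    by_cases haa : a = a'
    · subst haa
      simp [huniq b' (by simp)]
    · rw [beq_false_of_ne haa]
      refine ih ?_ fun b' hb' => huniq b' (List.mem_cons_of_mem _ hb')
      simpa [haa] using h

namespace GameNaming

variable {Q A : Type} {M : SymbolicModel Q A} {len : A → ℝ} {T : Copies Q A} {ν : ℝ}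
  (N : GameNaming M len T ν)

theorem lookup_edge (e : (M.game len T ν).E) : N.table.1.lookup (N.edge e) =
    some (N.vertex ((M.game len T ν).src e), N.vertex ((M.game len T ν).tgt e)) := by
  refine List.lookup_eq_some_of_unique ((N.mem_edges _).mpr ⟨e, rfl⟩) fun b hb => ?_
  obtain ⟨e', he'⟩ := (N.mem_edges _).mp hb
  obtain ⟨h1, rfl⟩ := Prod.mk.inj he'
  rw [N.edge_inj h1]

theorem lookup_state (q : Q) (c : T.C₁) :
    N.table.2.1.lookup (N.vertex (.inl (q, c))) = some (N.state q) := by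
  refine List.lookup_eq_some_of_unique ((N.mem_states _).mpr ⟨q, c, rfl⟩) fun b hb => ?_
  obtain ⟨q', c', h⟩ := (N.mem_states _).mp hb
  obtain ⟨h1, rfl⟩ := Prod.mk.inj h
  rw [(Prod.mk.inj (Sum.inl.inj (N.vertex_inj h1))).1]

theorem lookup_signal (q : Q) (u : M.signals) (d : T.C₂) :
    N.table.2.2.1.lookup (N.vertex (.inr (q, u, d))) = some (N.signal u) := by
  refine List.lookup_eq_some_of_unique ((N.mem_signals _).mpr ⟨q, u, d, rfl⟩) fun b hb => ?_
  obtain ⟨q', u', d', h⟩ := (N.mem_signals _).mp hb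
  obtain ⟨h1, rfl⟩ := Prod.mk.inj h
  rw [(Prod.mk.inj (Prod.mk.inj (Sum.inr.inj (N.vertex_inj h1))).2).1]

theorem lookup_initial (q : Q) :
    N.table.2.2.2.lookup (N.state q) = some (N.vertex (.inl (q, T.start))) := by
  refine List.lookup_eq_some_of_unique ((N.mem_initial _).mpr ⟨q, rfl⟩) fun b hb => ?_
  obtain ⟨q', h⟩ := (N.mem_initial _).mp hb
  obtain ⟨h1, rfl⟩ := Prod.mk.inj h
  rw [N.state_inj h1]

theorem targetSignal_edge (e : (M.game len T ν).E₁₂) :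
    N.table.targetSignal (N.edge (.inl e)) = some (N.signal e.1.2.1) := by
  rw [GameTable.targetSignal, N.lookup_edge]
  exact N.lookup_signal _ _ _

theorem reply_edge (e : (M.game len T ν).E₁₂) (q' : Q)
    (h : M.trans e.1.1.1 e.1.2.1 q') : N.table.reply (N.edge (.inl e)) (N.state q') =
      some (N.edge (.inr ⟨((e.1.1.1, e.1.2.1, e.1.2.2), q'), h⟩)) := by
  rw [GameTable.reply, N.lookup_edge, Option.bind_some]
  set f : (M.game len T ν).E₂₁ := ⟨((e.1.1.1, e.1.2.1, e.1.2.2), q'), h⟩ with hf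
  set l := List.filterMap _ N.table.1 with hl
  have hmem : ∀ x ∈ l, x = N.edge (.inr f) := by
    intro x hx
    obtain ⟨b, hb, hx⟩ := List.mem_filterMap.mp hx
    obtain ⟨g, rfl⟩ := (N.mem_edges _).mp hb
    rw [GameTable.edgeName] at hx
    split_ifs at hx with hcond
    obtain rfl := Option.some.inj hx
    obtain ⟨h1, h2⟩ := hcond
    have h1 := N.vertex_inj h1
    rcases g with g | g
    · exact absurd h1 Sum.inl_ne_inr
    · have h1 : g.1.1 = (e.1.1.1, e.1.2.1, e.1.2.2) := Sum.inr.inj h1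
      have h3 := (N.lookup_state g.1.2 (T.next g.1.1.2.2 g.1.1.1 g.1.1.2.1 g.1.2)).symm.trans h2
      have h4 := N.state_inj (Option.some.inj h3)
      rw [show g = f from Subtype.ext (Prod.ext h1 h4)]
  have hin : N.edge (.inr f) ∈ l := by
    refine List.mem_filterMap.mpr ⟨_, (N.mem_edges _).mpr ⟨.inr f, rfl⟩, ?_⟩
    exact if_pos ⟨rfl, N.lookup_state _ _⟩
  rcases hcase : l with _ | ⟨x, r⟩
  · rw [hcase] at hin; simp at hin
  · rw [List.head?_cons, hmem x (by rw [hcase]; simp)]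

/-- With the answers of the strategy, the algorithm simulates the play along the remaining history
`l` and outputs the signal that the strategy chooses at the end. -/
theorem exists_answers (s : (M.game len T ν).Strategy .one) (oracle : ℕ × List ℕ → Option ℕ)
    (ho : N.Represents oracle s) (v : (M.game len T ν).V) (l : List (A × Q)) :
    ∀ (es : List (M.game len T ν).E) (q : Q) (c : T.C₁), (M.game len T ν).IsFinitePlay v es →
      (M.game len T ν).lastVertex v es = .inl (q, c) → IsPath M.trans q l →
      ∃ as : List (Option ℕ),
        (∀ j (hj : j < as.length), ∃ p, (as.take j).foldl N.table.advance
            (.inl (l.map fun a => (N.signal a.1, N.state a.2), es.map N.edge)) = .inl p ∧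
          oracle (N.vertex v, p.2) = as[j]) ∧
        as.foldl N.table.advance
            (.inl (l.map fun a => (N.signal a.1, N.state a.2), es.map N.edge)) =
          .inr (((l.foldlM (SymbolicModel.extendPlay s v) es).bind fun es' =>
            (s.choose v es').bind SymbolicModel.edgeSignal).map N.signal) := by
  induction l with
  | nil =>
    intro es q c hes hlast _
    have hans := ho v es hes (by rw [hlast]; rfl)
    refine ⟨[(s.choose v es).map N.edge], ?_, ?_⟩
    · intro j hj
      obtain rfl : j = 0 := by simpa using hj
      exact ⟨_, rfl, hans⟩
    · rcases hch : s.choose v es with _ | e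
      · simp [GameTable.advance, hch]
      · obtain ⟨e, rfl, -⟩ := SymbolicModel.src_eq_inl
          ((s.src_choose v es hes (by rw [hlast]; rfl) e hch).trans hlast)
        simp [GameTable.advance, GameTable.advanceEdge, hch, N.targetSignal_edge,
          SymbolicModel.edgeSignal]
  | cons a l ih =>
    intro es q c hes hlast hpath
    obtain ⟨u, q'⟩ := a
    have hans := ho v es hes (by rw [hlast]; rfl)
    have hquery : ∀ as, as = [(s.choose v es).map N.edge] → ∀ j (hj : j < as.length),
        ∃ p, (as.take j).foldl N.table.advance (.inl (((u, q') :: l).map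
            fun a => (N.signal a.1, N.state a.2), es.map N.edge)) = .inl p ∧
          oracle (N.vertex v, p.2) = as[j] := by
      rintro _ rfl j hj
      obtain rfl : j = 0 := by simpa using hj
      exact ⟨_, rfl, hans⟩
    rcases hch : s.choose v es with _ | e
    · refine ⟨_, hquery _ rfl, ?_⟩
      simp [GameTable.advance, hch, SymbolicModel.extendPlay]
    · obtain ⟨e, rfl, hsrc⟩ := SymbolicModel.src_eq_inl
        ((s.src_choose v es hes (by rw [hlast]; rfl) e hch).trans hlast)
      have hq : e.1.1.1 = q := by rw [hsrc]
      by_cases hu : (e.1.2.1 : A) = u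
      · have htr : M.trans e.1.1.1 e.1.2.1 q' := by rw [hq, hu]; exact hpath.1
        set f : (M.game len T ν).E₂₁ := ⟨((e.1.1.1, e.1.2.1, e.1.2.2), q'), htr⟩ with hf
        have hext : SymbolicModel.extendPlay s v es (u, q') = some (es ++ [Sum.inl e, Sum.inr f]) :=
          SymbolicModel.extendPlay_eq_some.mpr ⟨e, htr, hch, hu, rfl⟩
        have hplay : (M.game len T ν).IsFinitePlay v (es ++ [Sum.inl e, Sum.inr f]) := by
          refine MPPG.isFinitePlay_append.mpr ⟨hes, ?_, rfl, trivial⟩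
          rw [hlast]
          exact congrArg Sum.inl hsrc
        obtain ⟨as, has, hout⟩ := ih (es ++ [Sum.inl e, Sum.inr f]) q'
          (T.next e.1.2.2 e.1.1.1 e.1.2.1 q') hplay
          (by rw [MPPG.lastVertex_append]; rfl) hpath.2
        have hadv : N.table.advance (.inl (((u, q') :: l).map
            fun a => (N.signal a.1, N.state a.2), es.map N.edge)) (some (N.edge (Sum.inl e))) =
            Sum.inl (l.map fun a => (N.signal a.1, N.state a.2),
              (es ++ [Sum.inl e, Sum.inr f]).map N.edge) := by
          simp [GameTable.advance, GameTable.advanceEdge, N.targetSignal_edge, hu,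
            N.reply_edge e q' htr, hf]
        refine ⟨some (N.edge (.inl e)) :: as, ?_, ?_⟩
        · rintro (_ | j) hj
          · refine ⟨_, rfl, ?_⟩
            rw [hch] at hans
            exact hans
          · rw [List.take_succ_cons, List.foldl_cons, hadv]
            exact has j (by simpa using hj)
        · rw [List.foldl_cons, hadv, hout, List.foldlM_cons, hext]
          rfl
      · have hne : N.signal e.1.2.1 ≠ N.signal u := fun h =>
          hu (N.signal_inj e.1.2.1.2 (M.trans_signal _ _ _ hpath.1) h)
        have hext : SymbolicModel.extendPlay s v es (u, q') = none := by
          rw [Option.eq_none_iff_forall_ne_some]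
          intro es' h
          obtain ⟨e', -, he', hu', -⟩ := SymbolicModel.extendPlay_eq_some.mp h
          obtain rfl := Sum.inl.inj (Option.some.inj (he'.symm.trans hch))
          exact hu hu'
        refine ⟨_, hquery _ rfl, ?_⟩
        simp [GameTable.advance, GameTable.advanceEdge, hch, N.targetSignal_edge, hne, hext]

theorem oracleOutputs_simulationStep (s : (M.game len T ν).Strategy .one)
    (oracle : ℕ × List ℕ → Option ℕ) (ho : N.Represents oracle s) (h : History Q A)
    (hh : M.IsFiniteRun h) :
    OracleOutputs simulationStep oracle (N.table, N.history h)
      ((SymbolicModel.strategyController s h).map N.signal) := by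
  obtain ⟨as, has, hout⟩ := N.exists_answers s oracle ho (.inl (h.1, T.start)) h.2 [] h.1 T.start
    trivial rfl hh
  refine ⟨as, fun j hj => ?_, ?_⟩
  · obtain ⟨p, hp, hans⟩ := has j hj
    refine ⟨(N.vertex (.inl (h.1, T.start)), p.2), ?_, hans⟩
    simp only [simulationStep, history]
    rw [List.map_nil] at hp
    rw [hp, N.lookup_initial]
    rfl
  · simp only [simulationStep, history]
    rw [List.map_nil] at hout
    rw [hout]
    rfl

end GameNaming

/-! ### Mean values -/

theorem sum_Icc_interleave_self (f : ℕ → ℝ) (h : ℕ) :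
    ∑ i ∈ Finset.Icc 1 (2 * h + 1), interleave f f i = f 0 + 2 * ∑ i ∈ Finset.Icc 1 h, f i := by
  induction h with
  | zero => simpa using interleave_two_mul_add_one f f 0
  | succ h ih =>
    rw [show 2 * (h + 1) + 1 = 2 * h + 1 + 1 + 1 by ring,
      Finset.sum_Icc_succ_top (by omega), Finset.sum_Icc_succ_top (by omega), ih,
      Finset.sum_Icc_succ_top (by omega), show 2 * h + 1 + 1 = 2 * (h + 1) by ring,
      interleave_two_mul, interleave_two_mul_add_one]
    ring

/-- Repeating every term of a sequence does not raise its limit average. -/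
theorem limitAverage_of_interleave_self {f : ℕ → ℝ} {ν : ℝ}
    (hf : (ν : EReal) ≤ limitAverage (interleave f f)) : (ν : EReal) ≤ limitAverage f := by
  refine le_of_forall_lt_imp_le_of_dense fun c hc => ?_
  obtain ⟨a, hca, haν⟩ := EReal.lt_iff_exists_real_btwn.mp hc
  refine hca.le.trans ?_
  have haν : a < ν := EReal.coe_lt_coe_iff.mp haν
  obtain ⟨b, hab, hbν⟩ := exists_between haν
  have hb := Filter.eventually_lt_of_lt_liminf ((EReal.coe_lt_coe_iff.mpr hbν).trans_le hf)
  obtain ⟨N, hN⟩ := Filter.eventually_atTop.mp hb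
  obtain ⟨K, hK⟩ := exists_nat_gt ((f 0 - b) / (2 * (b - a)))
  refine Filter.le_liminf_of_le (h := Filter.eventually_atTop.mpr ⟨N + K + 1, fun h hh => ?_⟩)
  have h1 : b < 1 / ((2 * h + 1 : ℕ) : ℝ) * ∑ i ∈ Finset.Icc 1 (2 * h + 1), interleave f f i :=
    EReal.coe_lt_coe_iff.mp (hN (2 * h + 1) (by omega))
  rw [sum_Icc_interleave_self, one_div_mul_eq_div, lt_div_iff₀ (by positivity)] at h1
  have hh0 : (0 : ℝ) < h := by exact_mod_cast (by omega : 0 < h)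
  have hKh : (K : ℝ) ≤ h := by exact_mod_cast (by omega : K ≤ h)
  have h2 : f 0 - b < h * (2 * (b - a)) :=
    (div_lt_iff₀ (by linarith)).mp (hK.trans_le hKh)
  refine EReal.coe_le_coe_iff.mpr ?_
  rw [one_div_mul_eq_div, le_div_iff₀ hh0]
  push_cast at h1
  linarith

/-! ### The system and its symbolic model -/

namespace ControlSystem

variable {n m : ℕ} {sys : ControlSystem n m} {βf βb : Signal m → ℝ≥0 → ℝ≥0 → ℝ≥0}
  {p : QuantParams}

theorem exists_gridPoint {η : ℝ≥0} (hη : 0 < η) (x : Fin n → ℝ) :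
    ∃ q : Fin n → ℝ, (∀ i, ∃ l : ℤ, q i = 2 * η * l) ∧ ‖x - q‖ ≤ η := by
  have h2 : (0 : ℝ) < 2 * η := by positivity
  refine ⟨fun i => 2 * η * round (x i / (2 * η)), fun i => ⟨_, rfl⟩, ?_⟩
  refine (pi_norm_le_iff_of_nonneg η.coe_nonneg).mpr fun i => ?_
  have h := abs_sub_round (x i / (2 * η))
  have h3 : x i - 2 * η * round (x i / (2 * η)) =
      2 * η * (x i / (2 * η) - round (x i / (2 * η))) := by
    rw [mul_sub, mul_div_cancel₀ _ h2.ne']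
  rw [Pi.sub_apply, h3, Real.norm_eq_abs, abs_mul, abs_of_pos h2]
  have := mul_le_mul_of_nonneg_left h h2.le
  linarith

theorem IsClosestPoint.mem_closedBall {η : ℝ≥0} (hη : 0 < η) {cl : sys.X → gridStates sys.X η}
    (hcl : sys.IsClosestPoint cl) (x : sys.X) :
    (x : Fin n → ℝ) ∈ Metric.closedBall (cl x : Fin n → ℝ) η := by
  obtain ⟨q, hq, hxq⟩ := exists_gridPoint hη (x : Fin n → ℝ)
  have hmem : q ∈ gridStates sys.X η := ⟨hq, x, by rwa [Metric.mem_closedBall, dist_eq_norm], x.2⟩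
  rw [Metric.mem_closedBall, dist_eq_norm]
  exact (hcl x ⟨q, hmem⟩).trans hxq

theorem IsClosestPoint.mem_init {cl : sys.X → gridStates sys.X p.η} (hcl : sys.IsClosestPoint cl)
    {x : sys.X} (hx : (x : Fin n → ℝ) ∈ sys.Xin) : cl x ∈ (sys.symbolicModel βf βb p).init :=
  ⟨(cl x).2.1, x, hcl.mem_closedBall p.η_pos x, hx⟩

/-- A step from a point near `q` by a signal that the symbolic model allows at `q` is matched by a
transition from `q` to every grid point near its end point. -/
theorem IncrementallyComplete.trans_of_step (hinc : sys.IncrementallyComplete βf βb)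
    {q q' q'' : gridStates sys.X p.η} {u : Signal m} {x x' : sys.X}
    (htr : (sys.symbolicModel βf βb p).trans q u q'')
    (hx : (x : Fin n → ℝ) ∈ Metric.closedBall (q : Fin n → ℝ) p.η)
    (hx' : (x' : Fin n → ℝ) ∈ Metric.closedBall (q' : Fin n → ℝ) p.η) (hstep : sys.Step x u x') :
    (sys.symbolicModel βf βb p).trans q u q' := by
  obtain ⟨hu, hfwd, hbwd, -⟩ := hstep
  rw [Metric.mem_closedBall, dist_eq_norm] at hx hx'
  refine ⟨htr.1, htr.2.1, ?_, ?_⟩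
  · obtain ⟨y, hy⟩ := hinc.fwd_nonempty q u hu u.len le_rfl
    refine ⟨y, hy, ?_⟩
    have h1 := hinc.fwd_bound q x u hu u.len le_rfl y hy x' hfwd
    have h2 : ‖(q : Fin n → ℝ) - x‖₊ ≤ p.η := by
      rw [← NNReal.coe_le_coe, coe_nnnorm, norm_sub_rev]; exact hx
    have h3 : (βf u ‖(q : Fin n → ℝ) - x‖₊ u.len : ℝ) ≤ βf u p.η u.len :=
      NNReal.coe_le_coe.mpr (hinc.fwd_mono u hu u.len h2)
    have h4 := norm_sub_le_norm_sub_add_norm_sub y (x' : Fin n → ℝ) (q' : Fin n → ℝ)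
    linarith
  · obtain ⟨y, hy⟩ := hinc.bwd_nonempty q' u hu u.len le_rfl
    refine ⟨y, hy, ?_⟩
    have h1 := hinc.bwd_bound q' x' u hu u.len le_rfl y hy x hbwd
    have h2 : ‖(q' : Fin n → ℝ) - x'‖₊ ≤ p.η := by
      rw [← NNReal.coe_le_coe, coe_nnnorm, norm_sub_rev]; exact hx'
    have h3 : (βb u ‖(q' : Fin n → ℝ) - x'‖₊ u.len : ℝ) ≤ βb u p.η u.len :=
      NNReal.coe_le_coe.mpr (hinc.bwd_mono u hu u.len h2)
    have h4 := norm_sub_le_norm_sub_add_norm_sub y (x : Fin n → ℝ) (q : Fin n → ℝ)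
    linarith

/-- A signal that the symbolic model allows at `q` can be applied at every point near `q`. -/
theorem BackwardCompatible.exists_step (hbc : sys.BackwardCompatible)
    (hsig : pwConstSignals sys.U p ⊆ sys.signals) {q q' : gridStates sys.X p.η} {u : Signal m}
    {x : sys.X} (htr : (sys.symbolicModel βf βb p).trans q u q')
    (hx : (x : Fin n → ℝ) ∈ Metric.closedBall (q : Fin n → ℝ) p.η) : ∃ x', sys.Step x u x' := by
  have hu := hsig htr.1
  obtain ⟨x', hx', hb⟩ := hbc x x.2 u hu
  exact ⟨⟨x', htr.2.1 x hx u.len le_rfl hx'⟩, hu, hx', hb, htr.2.1 x hx⟩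

/-- The part of a trajectory that belongs to one step of the run. -/
theorem IsTrajectory.isStepTrajectory {x : ℕ → sys.X} {u : ℕ → Signal m}
    {σ : ℝ≥0 → (Fin n → ℝ)} (hσ : sys.IsTrajectory x u σ) (k : ℕ) :
    sys.IsStepTrajectory (x k) (u k) (x (k + 1))
      fun t => σ (∑ i ∈ Finset.range k, (u i).len + t) := by
  intro t ht
  have h := hσ.2 k (∑ i ∈ Finset.range k, (u i).len + t) le_self_add
    (by rw [Finset.sum_range_succ]; gcongr)
  rw [add_tsub_cancel_left, Finset.sum_range_succ, add_tsub_add_eq_tsub_left] at h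
  exact ⟨hσ.1 _, h⟩

/-- A trajectory of a run passes the transitions of a symbolic run that stays near the run. -/
theorem IsTrajectory.timedRun {AP : Type*} {P : (Fin n → ℝ) → Set AP}
    {ρE ρA : gridStates sys.X p.η → Signal m → gridStates sys.X p.η → Set AP × Set AP}
    (hE : sys.SoundSome βf βb p P ρE) (hA : sys.SoundAll βf βb p P ρA)
    {x : ℕ → sys.X} {u : ℕ → Signal m} {σ : ℝ≥0 → (Fin n → ℝ)} (hrun : sys.IsRun x u)
    (hσ : sys.IsTrajectory x u σ) {q : ℕ → gridStates sys.X p.η}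
    (hq : ∀ i, (x i : Fin n → ℝ) ∈ Metric.closedBall (q i : Fin n → ℝ) p.η)
    (htr : ∀ i, (sys.symbolicModel βf βb p).trans (q i) (u i) (q (i + 1))) :
    TimedRun (sys.symbolicModel βf βb p) ρE ρA P σ
      (fun k => ∑ i ∈ Finset.range k, (u i).len) q u where
  zero := by simp
  mono := monotone_nat_of_le_succ fun k => by rw [Finset.sum_range_succ]; exact le_self_add
  unbounded t := by
    -- Every signal of the symbolic model lasts at least one time step `τ`.
    have hlen : ∀ i, p.τ ≤ (u i).len := by
      intro i
      obtain ⟨j, hj, hl, -⟩ := (htr i).1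
      rw [hl]
      exact le_mul_of_one_le_left zero_le (by exact_mod_cast hj)
    obtain ⟨k, hk⟩ := exists_lt_nsmul p.τ_pos t
    refine ⟨k, hk.trans_le ?_⟩
    simpa using Finset.card_nsmul_le_sum (Finset.range k) (fun i => (u i).len) p.τ
      fun i _ => hlen i
  trans := htr
  holds_all k φ hφ t h₁ h₂ := by
    have hs := hA _ _ _ (htr k) _ _ (hq k) (hq (k + 1)) (hrun k) _ (hσ.isStepTrajectory k)
      (t - ∑ i ∈ Finset.range k, (u i).len)
      (by rwa [tsub_le_iff_left, ← Finset.sum_range_succ])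
    rw [add_tsub_cancel_of_le h₁] at hs
    exact (StateFormula.Certified.sat hs.1 hs.2 φ).1 hφ
  holds_some k φ hφ := by
    obtain ⟨t, ht, hs⟩ := hE _ _ _ (htr k) _ _ (hq k) (hq (k + 1)) (hrun k) _
      (hσ.isStepTrajectory k)
    exact ⟨_, le_self_add, by rw [Finset.sum_range_succ]; gcongr,
      (StateFormula.Certified.sat hs.1 hs.2 φ).1 hφ⟩

/-! ### Runs of the controlled system -/

theorem isControlledFiniteRun_concat {C : Controller sys.X (Signal m)} {x : sys.X}
    {l : List (Signal m × sys.X)} {a : Signal m × sys.X} :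
    sys.IsControlledFiniteRun C (x, l ++ [a]) ↔ sys.IsControlledFiniteRun C (x, l) ∧
      sys.Step (pathEnd x l) a.1 a.2 ∧ C (x, l) = some a.1 := by
  simp only [IsControlledFiniteRun, IsFiniteRun, isPath_concat]
  constructor
  · rintro ⟨⟨h1, h2⟩, h3, h4⟩
    refine ⟨⟨h1, h3, fun i hi => ?_⟩, h2, ?_⟩
    · have := h4 i (by simp; omega)
      rwa [List.take_append_of_le_length hi.le, List.getElem_append_left hi] at this
    · simpa using h4 l.length (by simp)
  · rintro ⟨⟨h1, h3, h4⟩, h2, h5⟩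
    refine ⟨⟨h1, h2⟩, h3, fun i hi => ?_⟩
    rcases Nat.lt_or_ge i l.length with hil | hil
    · rw [List.take_append_of_le_length hil.le, List.getElem_append_left hil]
      exact h4 i hil
    · obtain rfl : i = l.length := by simp at hi; omega
      simpa using h5

theorem isControlledFiniteRun_historyOf_succ {C : Controller sys.X (Signal m)} {x : ℕ → sys.X}
    {u : ℕ → Signal m} {k : ℕ} :
    sys.IsControlledFiniteRun C (historyOf x u (k + 1)) ↔
      sys.IsControlledFiniteRun C (historyOf x u k) ∧ sys.Step (x k) (u k) (x (k + 1)) ∧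
        C (historyOf x u k) = some (u k) := by
  rw [historyOf_succ, isControlledFiniteRun_concat, pathEnd_historyOf]

theorem IsControlledFiniteRun.historyOf_mono {C : Controller sys.X (Signal m)} {x : ℕ → sys.X}
    {u : ℕ → Signal m} {j k : ℕ} (hjk : j ≤ k)
    (h : sys.IsControlledFiniteRun C (historyOf x u k)) :
    sys.IsControlledFiniteRun C (historyOf x u j) := by
  induction k, hjk using Nat.le_induction with
  | base => exact h
  | succ k _ ih => exact ih (isControlledFiniteRun_historyOf_succ.mp h).1

theorem isControlledRun_iff {C : Controller sys.X (Signal m)} {x : ℕ → sys.X}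
    {u : ℕ → Signal m} :
    sys.IsControlledRun C x u ↔ ∀ k, sys.IsControlledFiniteRun C (historyOf x u k) := by
  constructor
  · rintro ⟨h1, h2, h3⟩ k
    induction k with
    | zero => exact ⟨trivial, h2, fun i hi => absurd hi (Nat.not_lt_zero i)⟩
    | succ k ih => exact isControlledFiniteRun_historyOf_succ.mpr ⟨ih, h1 k, h3 k⟩
  · intro h
    exact ⟨fun i => (isControlledFiniteRun_historyOf_succ.mp (h (i + 1))).2.1, (h 0).2.1,
      fun i => (isControlledFiniteRun_historyOf_succ.mp (h (i + 1))).2.2⟩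

end ControlSystem

theorem pathEnd_map {X Q A : Type} (cl : X → Q) (x : X) (l : List (A × X)) :
    pathEnd (cl x) (l.map fun a => (a.1, cl a.2)) = cl (pathEnd x l) := by
  induction l generalizing x with
  | nil => rfl
  | cons a l ih => exact ih a.2

theorem SymbolicModel.refine_eq_some {Q A X : Type} {M : SymbolicModel Q A} {cl : X → Q}
    {S : Controller Q A} {h : History X A} {u : A} :
    M.refine cl S h = some u ↔ M.IsFiniteRun (cl h.1, h.2.map fun a => (a.1, cl a.2)) ∧
      S (cl h.1, h.2.map fun a => (a.1, cl a.2)) = some u := by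
  classical
  rw [SymbolicModel.refine]
  split_ifs with hfin <;> simp [hfin]

namespace ControlSystem

open SymbolicModel

variable {n m : ℕ} {sys : ControlSystem n m} {βf βb : Signal m → ℝ≥0 → ℝ≥0 → ℝ≥0}
  {p : QuantParams} {T : Copies (gridStates sys.X p.η) (Signal m)} {len : Signal m → ℝ} {ν : ℝ}
  {s : ((sys.symbolicModel βf βb p).game len T ν).Strategy .one}
  {cl : sys.X → gridStates sys.X p.η}

/-- The finite runs of the controlled system are matched by runs of the symbolic model along which
the strategy can be simulated. -/
theorem simulate_of_isControlledFiniteRun (hinc : sys.IncrementallyComplete βf βb)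
    (hcl : sys.IsClosestPoint cl)
    (hs : ∀ q ∈ (sys.symbolicModel βf βb p).init, s.WinningFrom (.inl (q, T.start)))
    {x : sys.X} {l : List (Signal m × sys.X)}
    (h : sys.IsControlledFiniteRun
      ((sys.symbolicModel βf βb p).refine cl (strategyController s)) (x, l)) :
    (sys.symbolicModel βf βb p).IsFiniteRun (cl x, l.map fun a => (a.1, cl a.2)) ∧
      ∃ es, simulate s (.inl (cl x, T.start)) (l.map fun a => (a.1, cl a.2)) = some es := by
  induction l using List.reverseRecOn with
  | nil => exact ⟨trivial, [], rfl⟩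
  | append_singleton l a ih =>
    obtain ⟨h₀, hstep, hC⟩ := isControlledFiniteRun_concat.mp h
    obtain ⟨hfin, es, hes⟩ := ih h₀
    obtain ⟨-, hS⟩ := refine_eq_some.mp hC
    obtain ⟨es', e, hes', he, hu⟩ := strategyController_eq_some.mp hS
    obtain rfl := Option.some.inj (hes.symm.trans hes')
    obtain ⟨e', he', hq, q', htr⟩ :=
      exists_choice_of_simulate (hs _ (hcl.mem_init h.2.1)) hes
    obtain rfl := Sum.inl.inj (Option.some.inj (he'.symm.trans he))
    rw [pathEnd_map] at hq htr
    rw [hu] at htr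
    have htr' := hinc.trans_of_step htr (hcl.mem_closedBall p.η_pos _)
      (hcl.mem_closedBall p.η_pos a.2) hstep
    rw [List.map_append, List.map_singleton]
    refine ⟨isPath_concat.mpr ⟨hfin, ?_⟩, ?_⟩
    · exact (pathEnd_map cl x l).symm ▸ htr'
    · rw [simulate_concat, hes, Option.bind_some]
      exact ⟨_, extendPlay_eq_some.mpr ⟨e', by rw [hq, hu]; exact htr', he, hu, rfl⟩⟩

/-- The controlled system has no deadlock. -/
theorem exists_extension_of_isControlledFiniteRun (hinc : sys.IncrementallyComplete βf βb)
    (hbc : sys.BackwardCompatible) (hsig : pwConstSignals sys.U p ⊆ sys.signals)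
    (hcl : sys.IsClosestPoint cl)
    (hs : ∀ q ∈ (sys.symbolicModel βf βb p).init, s.WinningFrom (.inl (q, T.start)))
    {h : History sys.X (Signal m)}
    (hh : sys.IsControlledFiniteRun
      ((sys.symbolicModel βf βb p).refine cl (strategyController s)) h) :
    ∃ a, sys.IsControlledFiniteRun
      ((sys.symbolicModel βf βb p).refine cl (strategyController s)) (h.1, h.2 ++ [a]) := by
  obtain ⟨hfin, es, hes⟩ := simulate_of_isControlledFiniteRun hinc hcl hs hh
  obtain ⟨e, he, -, q', htr⟩ := exists_choice_of_simulate (hs _ (hcl.mem_init hh.2.1)) hes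
  rw [pathEnd_map] at htr
  obtain ⟨x', hx'⟩ := hbc.exists_step hsig htr (hcl.mem_closedBall p.η_pos _)
  exact ⟨(e.1.2.1, x'), isControlledFiniteRun_concat.mpr ⟨hh, hx', refine_eq_some.mpr
    ⟨hfin, strategyController_eq_some.mpr ⟨es, e, hes, he, rfl⟩⟩⟩⟩

/-- The infinite runs of the controlled system are matched by runs of the symbolic model that follow
the strategy. -/
theorem IsControlledRun.symbolic (hinc : sys.IncrementallyComplete βf βb)
    (hcl : sys.IsClosestPoint cl)
    (hs : ∀ q ∈ (sys.symbolicModel βf βb p).init, s.WinningFrom (.inl (q, T.start)))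
    {x : ℕ → sys.X} {u : ℕ → Signal m}
    (h : sys.IsControlledRun
      ((sys.symbolicModel βf βb p).refine cl (strategyController s)) x u) :
    (∀ i, (sys.symbolicModel βf βb p).trans (cl (x i)) (u i) (cl (x (i + 1)))) ∧
      ∀ i, strategyController s (historyOf (fun i => cl (x i)) u i) = some (u i) := by
  have hmap : ∀ k, (cl (historyOf x u k).1, (historyOf x u k).2.map fun a => (a.1, cl a.2)) =
      historyOf (fun i => cl (x i)) u k := fun k => by simp [historyOf, Function.comp_def]
  refine ⟨fun i => ?_, fun i => ?_⟩
  · have hfin : (sys.symbolicModel βf βb p).IsFiniteRun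
        (historyOf (fun i => cl (x i)) u (i + 1)) := by
      rw [← hmap]
      exact (simulate_of_isControlledFiniteRun hinc hcl hs (isControlledRun_iff.mp h (i + 1))).1
    rw [historyOf_succ, SymbolicModel.IsFiniteRun, isPath_concat, pathEnd_historyOf] at hfin
    exact hfin.2
  · have := (refine_eq_some.mp (h.2.2 i)).2
    rwa [hmap] at this

end ControlSystem

/-! ### The synthesised controller -/

theorem mainTheorem2 :
    ∃ step : (GameTable × ℕ × List (ℕ × ℕ)) × List (Option ℕ) → (ℕ × List ℕ) ⊕ Option ℕ,
      Computable step ∧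
      ∀ {n m : ℕ} {AP : Type*} (sys : ControlSystem n m)
        (βf βb : Signal m → ℝ≥0 → ℝ≥0 → ℝ≥0) (_ : sys.IncrementallyComplete βf βb)
        (_ : sys.BackwardCompatible)
        (p : QuantParams) (_ : pwConstSignals sys.U p ⊆ sys.signals)
        (cl : sys.X → gridStates sys.X p.η) (_ : sys.IsClosestPoint cl)
        (P : (Fin n → ℝ) → Set AP)
        (ρE ρA : gridStates sys.X p.η → Signal m → gridStates sys.X p.η → Set AP × Set AP)
        (_ : sys.SoundSome βf βb p P ρE) (_ : sys.SoundAll βf βb p P ρA)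
        (Φ : PathFormula AP) (ν : ℝ) (_ : 0 < ν)
        (s : (gameOf sys βf βb p ρE ρA Φ ν).Strategy .one)
        (_ : ∀ q ∈ (sys.symbolicModel βf βb p).init, s.WinningFrom
          (.inl (q, (Φ.copies (sys.symbolicModel βf βb p) ρE ρA).start))),
        ∃ S : Controller (gridStates sys.X p.η) (Signal m),
          sys.SolvesSymbolic βf βb p cl P Φ ν S ∧
          ∀ (N : GameNaming (sys.symbolicModel βf βb p) (fun u => u.len)
              (Φ.copies (sys.symbolicModel βf βb p) ρE ρA) ν)
            (oracle : ℕ × List ℕ → Option ℕ), N.Represents oracle s →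
            ∀ h, (sys.symbolicModel βf βb p).IsFiniteRun h →
              OracleOutputs step oracle (N.table, N.history h) ((S h).map N.signal) := by
  refine ⟨simulationStep, primrec_simulationStep.to_comp, ?_⟩
  intro n m AP sys βf βb hinc hbc p hsig cl hcl P ρE ρA hE hA Φ ν _ s hs
  let T := Φ.copies (sys.symbolicModel βf βb p) ρE ρA
  let s' : ((sys.symbolicModel βf βb p).game (fun u => u.len) T ν).Strategy .one := s
  refine ⟨SymbolicModel.strategyController s', ⟨?_, ?_, ?_, ?_⟩, fun N oracle ho h hh =>
    N.oracleOutputs_simulationStep s' oracle ho h hh⟩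
  · intro h u hu
    obtain ⟨-, e, -, -, rfl⟩ := SymbolicModel.strategyController_eq_some.mp hu
    exact e.1.2.1.2
  · intro h hh
    obtain ⟨x, u, hxu, hall⟩ := exists_infinite_extension _ (fun h hh =>
      ControlSystem.exists_extension_of_isControlledFiniteRun hinc hbc hsig hcl hs hh) h hh
    refine ⟨x, u, ControlSystem.isControlledRun_iff.mpr fun k => ?_, hxu⟩
    exact (hall k).historyOf_mono (Nat.le_add_left k h.2.length)
  · intro x u hrun σ hσ
    obtain ⟨htr, hS⟩ := ControlSystem.IsControlledRun.symbolic hinc hcl hs hrun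
    obtain ⟨⟨c, d, hr, hp⟩, -⟩ := SymbolicModel.accepted_of_strategyController
      (q := fun i => cl (x i)) (hs _ (hcl.mem_init hrun.2.1)) htr hS
    exact (hσ.timedRun hE hA hrun.1 (fun i => hcl.mem_closedBall p.η_pos (x i))
      htr).sat_of_parityAccept Φ hr hp
  · intro x u hrun
    obtain ⟨htr, hS⟩ := ControlSystem.IsControlledRun.symbolic hinc hcl hs hrun
    exact limitAverage_of_interleave_self (SymbolicModel.accepted_of_strategyController
      (q := fun i => cl (x i)) (hs _ (hcl.mem_init hrun.2.1)) htr hS).2
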